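/- **Model.** Let $V$ be a finite set of users, $u_0\notin V$ a distinguished user, and $(V,E)$ a directed graph, where $(u,v)\in E$ means that $v$ follows $u$. If $B\subseteq V$ is the set of followings of $u_0$, all of whom follow $u_0$ back, then the tweets of $u_0$ are received exactly by the users in $B$. A tweet of $u_0$ spreads by a decreasing, order independent cascade: at time $0$ only $u_0$ is active; a node that becomes active at time $t$ makes one attempt to activate each of its inactive followers, who may become active at time $t+1$; the attempt of $u$ on $v$ succeeds with probability $p_v(u,S)$ when $S$ is the set of nodes that have already attempted to activate $v$. Here $p_v(u,S)\in[0,1]$ is non-increasing in $S$, the probability that a set of attempts on $v$ all fail does not depend on their order, and, within a time step, different users are activated independently. Let $\varphi(B)\subseteq V$ be the random set of users active at the end of the cascade, and $f(B)=\mathbb E|\varphi(B)|$ the expected number of retweets. **Reciprocation.** When $u_0$ starts following $v$, user $v$ reciprocates after a random delay $D_v\in[0,\infty]$; the family $(D_v)_{v\in V}$ has an arbitrary joint law and is independent of the cascade. Fix $T\in(0,\infty)$, an integer $K\ge 0$, and let $R=\{v\in V: D_v\le T\}$. The dynamic problem is to maximize $f(B)$ subject to $|B|\le K$ and $B\subseteq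 R$. Its greedy algorithm, which knows $R$, starts from $B=\emptyset$ and repeatedly adds to $B$ an element $v\in R\setminus B$ that maximizes $f(B\cup\{v\})-f(B)$, until $|B|=K$ or $B=R$. An *online algorithm* decides at which times to start and to stop following users, such that: its actions up to any time $t$ depend only on the reciprocations observed up to time $t$ among the users it has started to follow (and possibly on a random seed that is independent of the delays and of the cascade); each user is selected at most once; at most $K$ users are followed at any one time; and a user who has not reciprocated within time $T$ after being followed is no longer followed. Its result is the set $B$ of users that it follows and never drops, and its expected number of retweets is $\mathbb E[f(B)]$. The *practical greedy algorithm* starts with $B=\emptyset$. In each step it follows, among the users not tried yet, a user $v$ that maximizes $f(B\cup\{v\})-f(B)$ (ties are broken in any way, as a function of $B$ and of the set of users not tried yet). If $v$ reciprocates within time $T$, then $v$ is kept and added to $B$, and the next step starts at once; otherwise $v$ is dropped after time $T$ and the next step starts. It stops when $|B|=K$ or when all users have been tried. **Proposition.** The practical greedy algorithm is an online algorithm. For every realization of the delays, its result is a set that the greedy algorithm with a priori knowledge of $R$ selects for some way of breaking ties, and it is the same set that this algorithm selects when both use the same consistent tie-breaking rule (that is, the chosen candidate remains the choice when other candidates are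 removed, as for a fixed priority order). Its expected number of retweets is at least $(1-1/e)$ times the expected number of retweets of any online algorithm. -/

import Mathlib

open MeasureTheory
open scoped ENNReal NNReal

noncomputable section

/-! ### The cascade -/

/-- Probability that `v` resists successive contagion attempts from the senders in the list, in
this order, when the senders in `S` have already tried: `p v u S` is the probability that the
attempt of `u` on `v` succeeds, given that the senders in `S` have already attempted. -/
def resistProb {V : Type*} [DecidableEq V] (p : V → Option V → Finset (Option V) → ℝ) (v : V) :
    Finset (Option V) → List (Option V) → ℝ
  | _, [] => 1
  | S, u :: l => (1 - p v u S) * resistProb p v (insert u S) l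

/-- The users who may transmit a tweet to `v`: the users whom `v` follows in the graph, and the
distinguished user (`none`), whom `v` may come to follow. -/
def potentialSenders {V : Type*} [Fintype V] [DecidableEq V] (G : Digraph V) (v : V) :
    Finset (Option V) :=
  open Classical in
  insert none ((Finset.univ.filter fun u => G.Adj u v).image some)

/-- A decreasing, order independent cascade model on a finite set `V` of users, together with one
distinguished user `u₀ ∉ V`, represented by `none : Option V` (`some v` is the user `v ∈ V`).
`graph.Adj u v` means that `v` follows `u`, so tweets propagate from `u` to `v`. -/
structure DecreasingCascade (V : Type*) [Fintype V] [DecidableEq V] where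
  /-- the social graph without `u₀` -/
  graph : Digraph V
  /-- `p v u S`: probability that `v` reads and retweets the message (re)tweeted by `u`, given that
  the senders in `S` have already (re)tweeted it -/
  p : V → Option V → Finset (Option V) → ℝ
  p_mem : ∀ v, ∀ S ⊆ potentialSenders graph v, ∀ u ∈ potentialSenders graph v, u ∉ S →
    p v u S ∈ Set.Icc (0 : ℝ) 1
  /-- The more senders have tried in vain, the less likely the next attempt is to succeed. -/
  decreasing : ∀ v, ∀ S' ⊆ potentialSenders graph v, ∀ S ⊆ S',
    ∀ u ∈ potentialSenders graph v, u ∉ S' → p v u S' ≤ p v u S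
  /-- The probability that a set of attempts fails does not depend on the order of the attempts. -/
  order_independent : ∀ v, ∀ S ⊆ potentialSenders graph v, ∀ l l' : List (Option V),
    l.Nodup → l.Perm l' → (∀ u ∈ l, u ∈ potentialSenders graph v ∧ u ∉ S) →
    resistProb p v S l = resistProb p v S l'

namespace DecreasingCascade

variable {V : Type*} [Fintype V] [DecidableEq V] (M : DecreasingCascade V)

/-- The actual senders to `v` when the set of followers of `u₀` is `B`. -/
def senders (B : Finset V) (v : V) : Finset (Option V) :=
  (potentialSenders M.graph v).filter fun u => u = none → v ∈ B

/-- Probability that the inactive user `v` becomes active in a time step in which the nodes in `C`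
are contagious and the nodes in `P` are active but no longer contagious. (The order of the attempts
does not matter, by order independence.) -/
def activationProb (B : Finset V) (P C : Finset (Option V)) (v : V) : ℝ :=
  1 - resistProb M.p v (P ∩ M.senders B v) (C ∩ M.senders B v).toList

/-- The users in `V` that are active, when `P` and `C` are as in `activationProb`. -/
def activeUsers (P C : Finset (Option V)) : Finset V :=
  Finset.univ.filter fun v => some v ∈ P ∪ C

/-- Probability that exactly the users in `N` become active in this time step, for a set `N` of
inactive users: the inactive users are activated independently of one another. -/
def stepProb (B : Finset V) (P C : Finset (Option V)) (N : Finset V) : ℝ :=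
  (∏ v ∈ N, M.activationProb B P C v) *
    ∏ v ∈ (activeUsers P C)ᶜ \ N, (1 - M.activationProb B P C v)

/-- `cascadeProb B n P C F` is the probability that `F` is the set of active users of `V` after `n`
further time steps, starting from spent nodes `P` and contagious nodes `C`. -/
def cascadeProb (B : Finset V) :
    ℕ → Finset (Option V) → Finset (Option V) → Finset V → ℝ
  | 0, P, C, F => if activeUsers P C = F then 1 else 0
  | n + 1, P, C, F => ∑ N ∈ ((activeUsers P C)ᶜ).powerset,
      M.stepProb B P C N * cascadeProb B n (P ∪ C) (N.image some) F

/-- The law of the random set `φ(B)` of users of `V` who retweet a tweet of `u₀` when the followers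
of `u₀` are the users in `B`. Initially only `u₀` is active and contagious; the cascade is over after
at most `|V|` time steps. -/
def retweetersProb (B F : Finset V) : ℝ :=
  M.cascadeProb B (Fintype.card V) ∅ {none} F

/-- The expected number of retweets, `E|φ(B)|`. -/
def expectedRetweets (B : Finset V) : ℝ :=
  ∑ F : Finset V, M.retweetersProb B F * (F.card : ℝ)

/-- A greedy selection rule: given the set `B` already selected, `pick B C` is an element of the
set `C` of candidates (when `C` is nonempty) that brings the largest marginal increase of the
expected number of retweets. Ties may be broken in any way. -/
def IsGreedyRule (pick : Finset V → Finset V → V) : Prop :=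
  ∀ B C : Finset V, C.Nonempty → pick B C ∈ C ∧
    ∀ w ∈ C, M.expectedRetweets (insert w B) - M.expectedRetweets B ≤
      M.expectedRetweets (insert (pick B C) B) - M.expectedRetweets B

end DecreasingCascade

/-- The ties are broken consistently: the choice from a set of candidates remains the choice when
other candidates are removed. (For example: ties are broken by a fixed priority order.) -/
def BreaksTiesConsistently {V : Type*} (pick : Finset V → Finset V → V) : Prop :=
  ∀ B C C' : Finset V, C' ⊆ C → pick B C ∈ C' → pick B C' = pick B C

/-- The greedy algorithm with a priori knowledge of the set `R` of reciprocating users, after `n`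
selections: it repeatedly adds the element of `R` chosen by the rule `pick`. -/
def clairvoyantGreedy {V : Type*} [DecidableEq V] (pick : Finset V → Finset V → V)
    (R : Finset V) : ℕ → Finset V
  | 0 => ∅
  | n + 1 =>
    let B := clairvoyantGreedy pick R n
    if (R \ B).Nonempty then insert (pick B (R \ B)) B else B

/-! ### Online algorithms -/

/-- The actions of `u₀`: the time at which each user starts being followed (`⊤`: never) and the time
at which `u₀` stops following this user (`⊤`: never). Each user is selected at most once. -/
structure Schedule (V : Type*) where
  followTime : V → ℝ≥0∞
  unfollowTime : V → ℝ≥0∞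

namespace Schedule

variable {V : Type*} [Fintype V] (s : Schedule V)

/-- The users followed by `u₀` at time `t`. -/
def followedAt (t : ℝ≥0) : Finset V :=
  Finset.univ.filter fun v => s.followTime v ≤ t ∧ (t : ℝ≥0∞) < s.unfollowTime v

/-- The final set of followings of `u₀`: the users that are followed at some time and never
dropped. -/
def final : Finset V :=
  Finset.univ.filter fun v => s.followTime v ≠ ⊤ ∧ s.unfollowTime v = ⊤

end Schedule

/-- Two dates of an event (`⊤`: it never occurs) look the same to an observer up to time `t`. -/
def SameUpTo (t : ℝ≥0) (a b : ℝ≥0∞) : Prop :=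
  a = b ∨ ((t : ℝ≥0∞) < a ∧ (t : ℝ≥0∞) < b)

/-- `A` is an online algorithm for `u₀` that follows at most `K` users at the same time, selects each
user at most once, and tolerates reciprocation delays of at most `T`. Here `d v` is the delay with
which `v` reciprocates after `u₀` starts following `v` (`⊤`: never), and `A d` is the schedule
realized by the algorithm when the delays are `d`. -/
structure IsOnlineAlgorithm {V : Type*} [Fintype V] (K : ℕ) (T : ℝ≥0)
    (A : (V → ℝ≥0∞) → Schedule V) : Prop where
  follow_le_unfollow : ∀ d v, (A d).followTime v ≤ (A d).unfollowTime v
  capacity : ∀ d t, ((A d).followedAt t).card ≤ K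
  /-- A user who has not reciprocated within time `T` is no longer followed. -/
  drop_late : ∀ d v, (T : ℝ≥0∞) < d v → (A d).unfollowTime v ≤ (A d).followTime v + T
  /-- The actions up to time `t` only depend on the reciprocations observed up to time `t` (those of
  users that `u₀` has already started to follow). -/
  nonanticipative : ∀ d d' (t : ℝ≥0),
    (∀ v, (A d).followTime v ≤ t →
      SameUpTo t ((A d).followTime v + d v) ((A d).followTime v + d' v)) →
    ∀ v, SameUpTo t ((A d).followTime v) ((A d').followTime v) ∧
      SameUpTo t ((A d).unfollowTime v) ((A d').unfollowTime v)

/-- The state of the practical greedy algorithm: current time, selected users who have reciprocated,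
users tried so far, and record of the actions. -/
structure GreedyState (V : Type*) where
  time : ℝ≥0∞
  kept : Finset V
  tried : Finset V
  schedule : Schedule V

/-- One step of the practical greedy algorithm. Unless `K` users have reciprocated or all users have
been tried, it follows the user chosen by `pick` among the users not tried yet. If this user
reciprocates within time `T`, the user is kept and the step ends upon reciprocation; otherwise the
user is dropped after time `T` and the step ends. -/
def practicalGreedyStep {V : Type*} [Fintype V] [DecidableEq V] (K : ℕ) (T : ℝ≥0)
    (pick : Finset V → Finset V → V) (d : V → ℝ≥0∞) (s : GreedyState V) : GreedyState V :=
  if s.kept.card < K ∧ (s.tried)ᶜ.Nonempty then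
    let v := pick s.kept (s.tried)ᶜ
    if d v ≤ T then
      { time := s.time + d v
        kept := insert v s.kept
        tried := insert v s.tried
        schedule :=
          { followTime := Function.update s.schedule.followTime v s.time
            unfollowTime := s.schedule.unfollowTime } }
    else
      { time := s.time + T
        kept := s.kept
        tried := insert v s.tried
        schedule :=
          { followTime := Function.update s.schedule.followTime v s.time
            unfollowTime := Function.update s.schedule.unfollowTime v (s.time + T) } }
  else s

/-- The practical greedy algorithm, started at time `0`. It takes at most `|V|` steps. -/
def practicalGreedy {V : Type*} [Fintype V] [DecidableEq V] (K : ℕ) (T : ℝ≥0)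
    (pick : Finset V → Finset V → V) (d : V → ℝ≥0∞) : Schedule V :=
  ((practicalGreedyStep K T pick d)^[Fintype.card V]
    { time := 0
      kept := ∅
      tried := ∅
      schedule := { followTime := fun _ => ⊤, unfollowTime := fun _ => ⊤ } }).schedule

/-- The users who reciprocate within time `T` (those with `R_v = 1`). -/
def reciprocating {V : Type*} [Fintype V] (T : ℝ≥0) (d : V → ℝ≥0∞) : Finset V :=
  Finset.univ.filter fun v => d v ≤ T

end

noncomputable section

/-! ### Resistance to a set of attempts -/

/-! For fixed delays the result of any online algorithm is a subset of the set `R` of reciprocating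
users with at most `K` elements, hence feasible for the clairvoyant problem. It therefore suffices
that `f` is nonnegative, monotone and submodular, so that `greedy_bound` applies, and that the
practical greedy algorithm reproduces a run of the clairvoyant one. The inequality then holds for
each realization and is integrated.

Give each user an independent uniform threshold; the user becomes active once the probability of
resisting all active senders falls below it. By order independence this probability depends only on
the set of senders, and the factor by which it shrinks in a time step is the failure probability of
that step. Hence the least closed set of active nodes has the law of the final set of the cascade
(`volume_real_eq_sum_cascadeProb`). Sharing the thresholds between `B ⊆ B'` gives monotonicity.

For submodularity, the attempt of `u₀` on an additional follower `w` is postponed until the cascade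
from `B` has stopped at a set `X` (`retweetersProb_insert`). If it succeeds, the cascade restarts
from `w` with fresh thresholds. For larger `B` and `X` the late attempt is less likely to succeed,
and the restart adds fewer users because its attempts follow more failures (`lateGain_anti`). The
shared first thresholds provide the inclusion between the two sets `X`.

As for the algorithm, a tried user who is not kept lies outside `R`, so every remaining element of
`R` is untried. A best untried user who turns out to reciprocate is thus also a best element of `R \
B`. Nonanticipation holds because the runs for two families of delays coincide step by step until an
observation separates them, after which neither changes its past. -/

theorem resistProb_append {V : Type*} [DecidableEq V] (p : V → Option V → Finset (Option V) → ℝ)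
    (v : V) (l₂ : List (Option V)) : ∀ (l₁ : List (Option V)) (S : Finset (Option V)),
    resistProb p v S (l₁ ++ l₂) =
      resistProb p v S l₁ * resistProb p v (S ∪ l₁.toFinset) l₂
  | [], S => by simp [resistProb]
  | u :: l₁, S => by
    simp only [List.cons_append, resistProb, resistProb_append p v l₂ l₁, List.toFinset_cons,
      mul_assoc, Finset.insert_union, Finset.union_insert]

theorem disjoint_inter_sdiff_inter {α : Type*} [DecidableEq α] (R A U : Finset α) :
    Disjoint (R ∩ U) ((A \ R) ∩ U) :=
  (Finset.disjoint_sdiff (s := R) (t := A)).mono Finset.inter_subset_left Finset.inter_subset_left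

namespace DecreasingCascade

variable {V : Type*} [Fintype V] [DecidableEq V] (M : DecreasingCascade V)

theorem resistProb_mem_Icc (v : V) : ∀ (l : List (Option V)) (S : Finset (Option V)),
    S ⊆ potentialSenders M.graph v → l.Nodup →
    (∀ u ∈ l, u ∈ potentialSenders M.graph v ∧ u ∉ S) →
    resistProb M.p v S l ∈ Set.Icc (0 : ℝ) 1
  | [], S, _, _, _ => by simp [resistProb]
  | u :: l, S, hS, hl, h => by
    have hu := h u (by simp)
    have hp := M.p_mem v S hS u hu.1 hu.2
    have hl' := List.nodup_cons.1 hl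
    have ih := resistProb_mem_Icc v l (insert u S) (Finset.insert_subset hu.1 hS) hl'.2
      (fun x hx => ⟨(h x (by simp [hx])).1, by
        simp only [Finset.mem_insert, not_or]
        exact ⟨fun e => hl'.1 (e ▸ hx), (h x (by simp [hx])).2⟩⟩)
    simp only [resistProb, Set.mem_Icc] at *
    constructor
    · exact mul_nonneg (by linarith) ih.1
    · exact mul_le_one₀ (by linarith) ih.1 ih.2

/-- Each factor `1 - p v u S` can only grow with `S`, by `decreasing`, and both lists are processed
in the same order. -/
theorem resistProb_mono_left (v : V) : ∀ (l : List (Option V)) (S S' : Finset (Option V)),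
    S ⊆ S' → S' ⊆ potentialSenders M.graph v → l.Nodup →
    (∀ u ∈ l, u ∈ potentialSenders M.graph v ∧ u ∉ S') →
    resistProb M.p v S l ≤ resistProb M.p v S' l
  | [], S, S', _, _, _, _ => by simp [resistProb]
  | u :: l, S, S', hSS, hS, hl, h => by
    have hu := h u (by simp)
    have hl' := List.nodup_cons.1 hl
    have hmem : ∀ x ∈ l, x ∈ potentialSenders M.graph v ∧ x ∉ insert u S' := fun x hx =>
      ⟨(h x (by simp [hx])).1, by
        simp only [Finset.mem_insert, not_or]
        exact ⟨fun e => hl'.1 (e ▸ hx), (h x (by simp [hx])).2⟩⟩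
    have hins := Finset.insert_subset_insert u hSS
    have hins' := Finset.insert_subset hu.1 hS
    have ih := resistProb_mono_left v l (insert u S) (insert u S') hins hins' hl'.2 hmem
    have h0 := (M.resistProb_mem_Icc v l (insert u S) (hins.trans hins') hl'.2
      (fun x hx => ⟨(hmem x hx).1, fun hx' => (hmem x hx).2 (hins hx')⟩)).1
    have hp := M.p_mem v S' hS u hu.1 hu.2
    have hd := M.decreasing v S' hS S hSS u hu.1 hu.2
    exact mul_le_mul (by linarith) ih h0 (by linarith [hp.2])

/-- The probability that the attempts of all the senders in `L` on `v` fail, when the senders in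
`S` have already tried. -/
def resist (v : V) (S L : Finset (Option V)) : ℝ :=
  resistProb M.p v S L.toList

variable {M}

@[simp]
theorem resist_empty (v : V) (S : Finset (Option V)) : M.resist v S ∅ = 1 := by
  simp [resist, resistProb]

theorem resist_singleton (v : V) (S : Finset (Option V)) (u : Option V) :
    M.resist v S {u} = 1 - M.p v u S := by
  simp [resist, resistProb]

theorem resist_mem_Icc {v : V} {S L : Finset (Option V)} (hS : S ⊆ potentialSenders M.graph v)
    (hL : L ⊆ potentialSenders M.graph v) (h : Disjoint S L) :
    M.resist v S L ∈ Set.Icc (0 : ℝ) 1 :=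
  M.resistProb_mem_Icc v _ S hS L.nodup_toList fun _ hu =>
    ⟨hL (Finset.mem_toList.1 hu), Finset.disjoint_right.1 h (Finset.mem_toList.1 hu)⟩

theorem resist_mono_left {v : V} {S S' L : Finset (Option V)} (hSS : S ⊆ S')
    (hS : S' ⊆ potentialSenders M.graph v) (hL : L ⊆ potentialSenders M.graph v)
    (h : Disjoint S' L) : M.resist v S L ≤ M.resist v S' L :=
  M.resistProb_mono_left v _ S S' hSS hS L.nodup_toList fun _ hu =>
    ⟨hL (Finset.mem_toList.1 hu), Finset.disjoint_right.1 h (Finset.mem_toList.1 hu)⟩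

/-- This is where order independence enters: the enumeration of the union may be replaced by one
that lists `L₁` before `L₂`. -/
theorem resist_union {v : V} {S L₁ L₂ : Finset (Option V)}
    (hS : S ⊆ potentialSenders M.graph v) (hL₁ : L₁ ⊆ potentialSenders M.graph v)
    (hL₂ : L₂ ⊆ potentialSenders M.graph v) (h₁ : Disjoint S L₁) (h₂ : Disjoint S L₂)
    (h : Disjoint L₁ L₂) :
    M.resist v S (L₁ ∪ L₂) = M.resist v S L₁ * M.resist v (S ∪ L₁) L₂ := by
  have hperm : (L₁ ∪ L₂).toList.Perm (L₁.toList ++ L₂.toList) := by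
    rw [List.perm_ext_iff_of_nodup (Finset.nodup_toList _)]
    · simp
    · rw [List.nodup_append']
      refine ⟨L₁.nodup_toList, L₂.nodup_toList, fun x hx hx' => ?_⟩
      exact Finset.disjoint_left.1 h (Finset.mem_toList.1 hx) (Finset.mem_toList.1 hx')
  have := M.order_independent v S hS _ _ (Finset.nodup_toList _) hperm (fun u hu => by
    rw [Finset.mem_toList, Finset.mem_union] at hu
    rcases hu with hu | hu
    · exact ⟨hL₁ hu, Finset.disjoint_right.1 h₁ hu⟩
    · exact ⟨hL₂ hu, Finset.disjoint_right.1 h₂ hu⟩)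
  unfold resist
  rw [this, resistProb_append, Finset.toList_toFinset]

theorem resist_anti_right {v : V} {S L L' : Finset (Option V)} (hLL : L' ⊆ L)
    (hS : S ⊆ potentialSenders M.graph v) (hL : L ⊆ potentialSenders M.graph v)
    (h : Disjoint S L) : M.resist v S L ≤ M.resist v S L' := by
  have hd : Disjoint S L' := h.mono_right hLL
  have hd' : Disjoint S (L \ L') := h.mono_right Finset.sdiff_subset
  rw [← Finset.union_sdiff_of_subset hLL, resist_union hS (hLL.trans hL)
    (Finset.sdiff_subset.trans hL) hd hd' Finset.disjoint_sdiff]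
  have h1 := resist_mem_Icc hS (hLL.trans hL) hd
  have h2 := resist_mem_Icc (M := M) (S := S ∪ L') (L := L \ L')
    (Finset.union_subset hS (hLL.trans hL)) (Finset.sdiff_subset.trans hL)
    (Finset.disjoint_union_left.2 ⟨hd', Finset.disjoint_sdiff⟩)
  exact mul_le_of_le_one_right h1.1 h2.2

theorem mem_senders {B : Finset V} {v : V} {u : Option V} :
    u ∈ M.senders B v ↔ u ∈ potentialSenders M.graph v ∧ (u = none → v ∈ B) := by
  simp [senders]

theorem senders_subset (B : Finset V) (v : V) : M.senders B v ⊆ potentialSenders M.graph v :=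
  Finset.filter_subset _ _

theorem senders_mono {B B' : Finset V} (h : B ⊆ B') (v : V) : M.senders B v ⊆ M.senders B' v :=
  fun _ hu => by
    rw [mem_senders] at hu ⊢
    exact ⟨hu.1, fun e => h (hu.2 e)⟩

theorem none_mem_potentialSenders (v : V) : none ∈ potentialSenders M.graph v := by
  simp [potentialSenders]

theorem none_mem_senders {B : Finset V} {v : V} : none ∈ M.senders B v ↔ v ∈ B := by
  simp [mem_senders, none_mem_potentialSenders]

theorem some_mem_senders {B : Finset V} {v u : V} :
    some u ∈ M.senders B v ↔ some u ∈ potentialSenders M.graph v := by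
  simp [mem_senders]

variable (M)

/-- The probability that `v` resists the attempts of all active nodes in `A`, given that it has
resisted those of the nodes in `R`, when `u₀` is followed by the users in `B`. -/
def resistance (B : Finset V) (R : Finset (Option V)) (v : V) (A : Finset (Option V)) : ℝ :=
  M.resist v (R ∩ M.senders B v) ((A \ R) ∩ M.senders B v)

variable {M}

theorem resistance_mem_Icc (B : Finset V) (R : Finset (Option V)) (v : V)
    (A : Finset (Option V)) : M.resistance B R v A ∈ Set.Icc (0 : ℝ) 1 :=
  resist_mem_Icc (Finset.inter_subset_right.trans (senders_subset B v))
    (Finset.inter_subset_right.trans (senders_subset B v)) (disjoint_inter_sdiff_inter _ _ _)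

theorem resistance_antitone (B : Finset V) (R : Finset (Option V)) (v : V) :
    Antitone (M.resistance B R v) := fun _ _ h =>
  resist_anti_right (Finset.inter_subset_inter_right (Finset.sdiff_subset_sdiff h subset_rfl))
    (Finset.inter_subset_right.trans (senders_subset B v))
    (Finset.inter_subset_right.trans (senders_subset B v)) (disjoint_inter_sdiff_inter _ _ _)

@[simp]
theorem resistance_self (B : Finset V) (R : Finset (Option V)) (v : V) :
    M.resistance B R v R = 1 := by
  simp [resistance]

/-- Chain rule for failures. It means that a uniform threshold known to be at most the resistance to
`P` exceeds the resistance to `P ∪ C` with conditional probability `activationProb B P C v`, if the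
former is nonzero. -/
theorem resistance_union (B : Finset V) {R P C : Finset (Option V)} (hR : R ⊆ P)
    (hPC : Disjoint P C) (v : V) :
    M.resistance B R v (P ∪ C) =
      M.resistance B R v P * (1 - M.activationProb B P C v) := by
  have hsub := senders_subset (M := M) B v
  have e1 : ((P ∪ C) \ R) ∩ M.senders B v = (P \ R) ∩ M.senders B v ∪ C ∩ M.senders B v := by
    ext x
    have : x ∈ C → x ∉ R := fun hx hx' => Finset.disjoint_left.1 hPC (hR hx') hx
    simp only [Finset.mem_inter, Finset.mem_sdiff, Finset.mem_union]
    tauto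
  have e2 : R ∩ M.senders B v ∪ (P \ R) ∩ M.senders B v = P ∩ M.senders B v := by
    rw [← Finset.union_inter_distrib_right, Finset.union_sdiff_of_subset hR]
  unfold resistance activationProb
  rw [e1, resist_union (Finset.inter_subset_right.trans hsub)
    (Finset.inter_subset_right.trans hsub) (Finset.inter_subset_right.trans hsub)
    (disjoint_inter_sdiff_inter _ _ _)
    ((hPC.mono_left hR).mono Finset.inter_subset_left Finset.inter_subset_left)
    (hPC.mono (Finset.inter_subset_left.trans Finset.sdiff_subset) Finset.inter_subset_left), e2]
  simp [resist]

theorem resistance_le_of_subset {B B' : Finset V} (h : B ⊆ B') (v : V)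
    (A : Finset (Option V)) : M.resistance B' ∅ v A ≤ M.resistance B ∅ v A := by
  simp only [resistance, Finset.empty_inter]
  exact resist_anti_right (Finset.inter_subset_inter_left (senders_mono h v)) (by simp)
    (Finset.inter_subset_right.trans (senders_subset B' v)) (by simp)

theorem resistance_insert_of_ne {B : Finset V} {w v : V} (h : v ≠ w) (R A : Finset (Option V)) :
    M.resistance (insert w B) R v A = M.resistance B R v A := by
  have : M.senders (insert w B) v = M.senders B v := by
    ext u
    simp [mem_senders, h]
  simp [resistance, this]

/-- The attempt of `u₀` on an additional follower may be assumed to come last. -/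
theorem resistance_insert_self {B : Finset V} {w : V} (h : w ∉ B) {A : Finset (Option V)}
    (hA : none ∈ A) :
    M.resistance (insert w B) ∅ w A =
      M.resistance B ∅ w A * (1 - M.p w none (A ∩ M.senders B w)) := by
  have e : A ∩ M.senders (insert w B) w = A ∩ M.senders B w ∪ {none} := by
    ext u
    rcases u with _ | u <;> simp [mem_senders, hA, none_mem_potentialSenders]
  have hn : none ∉ M.senders B w := by simpa [none_mem_senders] using h
  simp only [resistance, Finset.empty_inter, Finset.sdiff_empty, e]
  rw [resist_union (by simp) (Finset.inter_subset_right.trans (senders_subset B w))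
    (by simpa using none_mem_potentialSenders w) (by simp) (by simp)
    (by simp [hn]), Finset.empty_union, resist_singleton]

end DecreasingCascade
end

noncomputable section

/-! ### Threshold processes -/

section Threshold

variable {V : Type*} [Fintype V] [DecidableEq V]

/-- A set of active nodes is closed if no further user passes its threshold: the user `v` resists
the set `D` of active nodes if and only if `θ v ≤ h v D`. -/
def IsThresholdClosed (h : V → Finset (Option V) → ℝ) (θ : V → unitInterval)
    (D : Finset (Option V)) : Prop :=
  ∀ v, h v D < θ v → some v ∈ D

open Classical in
/-- The final set of active nodes of the threshold process started from `A`. -/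
def thresholdClosure (h : V → Finset (Option V) → ℝ) (θ : V → unitInterval)
    (A : Finset (Option V)) : Finset (Option V) :=
  Finset.univ.filter fun x => ∀ D, A ⊆ D → IsThresholdClosed h θ D → x ∈ D

/-- The users among the nodes in `A`. -/
def usersOf (A : Finset (Option V)) : Finset V :=
  Finset.univ.filter fun v => some v ∈ A

@[simp]
theorem mem_usersOf {A : Finset (Option V)} {v : V} : v ∈ usersOf A ↔ some v ∈ A := by
  simp [usersOf]

theorem activeUsers_eq_usersOf (P C : Finset (Option V)) :
    DecreasingCascade.activeUsers P C = usersOf (P ∪ C) := rfl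

theorem usersOf_mono {A B : Finset (Option V)} (h : A ⊆ B) : usersOf A ⊆ usersOf B := fun v => by
  simpa using @h (some v)

variable {h : V → Finset (Option V) → ℝ} {θ : V → unitInterval} {A D : Finset (Option V)}

theorem subset_thresholdClosure : A ⊆ thresholdClosure h θ A := fun x hx => by
  simp only [thresholdClosure, Finset.mem_filter, Finset.mem_univ, true_and]
  exact fun D hD _ => hD hx

theorem thresholdClosure_subset (hA : A ⊆ D) (hD : IsThresholdClosed h θ D) :
    thresholdClosure h θ A ⊆ D := fun x hx => by
  simp only [thresholdClosure, Finset.mem_filter, Finset.mem_univ, true_and] at hx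
  exact hx D hA hD

/-- Since `h v` is antitone, a user who passes its threshold against the intersection of the closed
supersets of `A` does so against each of them. So the closure is the least closed superset. -/
theorem isThresholdClosed_thresholdClosure (hh : ∀ v, Antitone (h v)) :
    IsThresholdClosed h θ (thresholdClosure h θ A) := fun v hv => by
  simp only [thresholdClosure, Finset.mem_filter, Finset.mem_univ, true_and]
  exact fun D hA hD => hD v ((hh v (thresholdClosure_subset hA hD)).trans_lt hv)

theorem IsThresholdClosed.closure_eq (hA : IsThresholdClosed h θ A) :
    thresholdClosure h θ A = A :=
  (thresholdClosure_subset subset_rfl hA).antisymm subset_thresholdClosure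

/-- Users who pass their thresholds belong to the closure anyway, so the time at which they are
added is irrelevant. This allows the closure to be followed one time step at a time. -/
theorem thresholdClosure_union_image (hh : ∀ v, Antitone (h v)) {N : Finset V}
    (hN : ∀ v ∈ N, h v A < θ v) :
    thresholdClosure h θ (A ∪ N.image some) = thresholdClosure h θ A := by
  have hcl := isThresholdClosed_thresholdClosure (h := h) (θ := θ) (A := A) hh
  apply Finset.Subset.antisymm
  · refine thresholdClosure_subset (Finset.union_subset subset_thresholdClosure ?_) hcl
    intro x hx
    obtain ⟨v, hv, rfl⟩ := Finset.mem_image.1 hx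
    exact hcl v ((hh v subset_thresholdClosure).trans_lt (hN v hv))
  · exact thresholdClosure_subset (Finset.subset_union_left.trans subset_thresholdClosure)
      (isThresholdClosed_thresholdClosure hh)

theorem measurableSet_isThresholdClosed (h : V → Finset (Option V) → ℝ)
    (D : Finset (Option V)) : MeasurableSet {θ : V → unitInterval | IsThresholdClosed h θ D} := by
  have : {θ : V → unitInterval | IsThresholdClosed h θ D} =
      ⋂ v, {θ : V → unitInterval | h v D < θ v → some v ∈ D} := by
    ext θ
    simp [IsThresholdClosed]
  rw [this]
  refine MeasurableSet.iInter fun v => ?_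
  by_cases hv : some v ∈ D
  · simp [hv]
  · simp only [hv, imp_false, not_lt]
    exact measurableSet_le (by fun_prop) measurable_const

theorem measurableSet_thresholdClosure (h : V → Finset (Option V) → ℝ)
    (A : Finset (Option V)) (Q : Finset (Option V) → Prop) :
    MeasurableSet {θ : V → unitInterval | Q (thresholdClosure h θ A)} := by
  have hm : ∀ x, MeasurableSet {θ : V → unitInterval | x ∈ thresholdClosure h θ A} := fun x => by
    have : {θ : V → unitInterval | x ∈ thresholdClosure h θ A} = ⋂ D : Finset (Option V),
        {θ : V → unitInterval | A ⊆ D → IsThresholdClosed h θ D → x ∈ D} := by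
      ext θ
      simp [thresholdClosure]
    rw [this]
    refine MeasurableSet.iInter fun D => ?_
    by_cases h1 : A ⊆ D <;> by_cases h2 : x ∈ D <;> simp only [h1, h2, forall_true_left,
      implies_true, forall_false, Set.ofPred_true, MeasurableSet.univ, imp_false]
    exact (measurableSet_isThresholdClosed h D).compl
  have : {θ : V → unitInterval | Q (thresholdClosure h θ A)} = ⋃ D ∈ {D | Q D}, ⋂ x,
      {θ : V → unitInterval | x ∈ thresholdClosure h θ A ↔ x ∈ D} := by
    ext θ
    simp only [Set.mem_ofPred_eq, Set.mem_iUnion, Set.mem_iInter, exists_prop]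
    constructor
    · exact fun hQ => ⟨_, hQ, fun x => Iff.rfl⟩
    · rintro ⟨D, hD, e⟩
      rwa [Finset.ext e]
  rw [this]
  refine MeasurableSet.biUnion (Set.to_countable _) fun D _ => MeasurableSet.iInter fun x => ?_
  by_cases hx : x ∈ D
  · simpa [hx] using hm x
  · simp only [hx, iff_false]
    exact (hm x).compl

end Threshold

/-! ### Volumes of boxes of uniform thresholds -/

/-- The thresholds of at most `a`. -/
def lowThresholds (a : ℝ) : Set unitInterval := {x | (x : ℝ) ≤ a}

@[simp]
theorem mem_lowThresholds {a : ℝ} {x : unitInterval} : x ∈ lowThresholds a ↔ (x : ℝ) ≤ a :=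
  Iff.rfl

theorem measurableSet_lowThresholds (a : ℝ) : MeasurableSet (lowThresholds a) :=
  measurableSet_le measurable_subtype_coe measurable_const

theorem volume_real_lowThresholds {a : ℝ} (ha : a ∈ Set.Icc (0 : ℝ) 1) :
    (volume : Measure unitInterval).real (lowThresholds a) = a := by
  have : lowThresholds a = Set.Iic ⟨a, ha⟩ := rfl
  rw [measureReal_def, this, unitInterval.volume_Iic, ENNReal.toReal_ofReal ha.1]

theorem volume_real_lowThresholds_diff {a b : ℝ} (ha : a ∈ Set.Icc (0 : ℝ) 1)
    (hb : b ∈ Set.Icc (0 : ℝ) 1) (hab : a ≤ b) :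
    (volume : Measure unitInterval).real (lowThresholds b \ lowThresholds a) = b - a := by
  have : lowThresholds b \ lowThresholds a = Set.Ioc ⟨a, ha⟩ ⟨b, hb⟩ := by
    ext x
    simp only [Set.mem_sdiff, mem_lowThresholds, not_le, Set.mem_Ioc]
    exact and_comm
  rw [measureReal_def, this, unitInterval.volume_Ioc, ENNReal.toReal_ofReal (by simpa using hab)]

theorem volume_real_univ_pi {V : Type*} [Fintype V] (I : V → Set unitInterval) :
    (volume : Measure (V → unitInterval)).real (Set.univ.pi I) =
      ∏ v, (volume : Measure unitInterval).real (I v) := by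
  simp [measureReal_def, volume_pi, Measure.pi_pi, ENNReal.toReal_prod]

/-! ### Coupling of the cascade with the threshold process -/

namespace DecreasingCascade

variable {V : Type*} [Fintype V] [DecidableEq V] {M : DecreasingCascade V}

theorem activationProb_empty (B : Finset V) (P : Finset (Option V)) (v : V) :
    M.activationProb B P ∅ v = 0 := by
  simp [activationProb, resistProb]

theorem stepProb_empty (B : Finset V) (P : Finset (Option V)) (N : Finset V) :
    M.stepProb B P ∅ N = if N = ∅ then 1 else 0 := by
  simp only [stepProb, activationProb_empty, sub_zero, Finset.prod_const_one, mul_one,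
    Finset.prod_const, zero_pow_eq, Finset.card_eq_zero]

theorem cascadeProb_zero (B : Finset V) (P C : Finset (Option V)) (F : Finset V) :
    M.cascadeProb B 0 P C F = if usersOf (P ∪ C) = F then 1 else 0 := rfl

theorem cascadeProb_empty (B : Finset V) (P : Finset (Option V)) (F : Finset V) :
    ∀ n, M.cascadeProb B n P ∅ F = if usersOf P = F then 1 else 0
  | 0 => by simp [cascadeProb_zero]
  | n + 1 => by
    simp only [cascadeProb, stepProb_empty, ite_mul, one_mul, zero_mul, Finset.sum_ite_eq',
      Finset.mem_powerset, Finset.empty_subset, if_true, Finset.union_empty, Finset.image_empty,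
      cascadeProb_empty B P F n]

theorem stepProb_eq_prod (B : Finset V) (P C : Finset (Option V)) (N : Finset V) :
    M.stepProb B P C N = ∏ v, if v ∈ N then M.activationProb B P C v else
      if some v ∈ P ∪ C then 1 else 1 - M.activationProb B P C v := by
  rw [Finset.prod_ite, stepProb, activeUsers_eq_usersOf]
  congr 1
  · simp
  · rw [Finset.prod_ite, Finset.prod_const_one, one_mul]
    refine Finset.prod_congr ?_ fun _ _ => rfl
    ext v
    simp
    tauto

/-- Comparison of the cascade with events that depend on independent uniform thresholds: `E A` is
an event that does not change when users who pass their thresholds are added to `A`, and `val X` is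
its conditional probability given that the cascade stops with the active users `X`. -/
theorem volume_real_eq_sum_cascadeProb (B : Finset V) (R : Finset (Option V))
    (E : Finset (Option V) → Set (V → unitInterval)) (hE : ∀ A, MeasurableSet (E A))
    (hinv : ∀ A (N : Finset V) θ, (∀ v ∈ N, M.resistance B R v A < θ v) →
      (θ ∈ E (A ∪ N.image some) ↔ θ ∈ E A))
    (val : Finset V → ℝ)
    (hval : ∀ P, R ⊆ P → none ∈ P → ∀ I : V → Set unitInterval, (∀ v, MeasurableSet (I v)) →
      (∀ v, some v ∉ P → I v = lowThresholds (M.resistance B R v P)) →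
      (volume : Measure (V → unitInterval)).real (Set.univ.pi I ∩ E P) =
        (∏ v, (volume : Measure unitInterval).real (I v)) * val (usersOf P)) :
    ∀ (n : ℕ) (P C : Finset (Option V)), R ⊆ P → Disjoint P C → none ∈ P ∪ C →
      (usersOf (P ∪ C))ᶜ.card ≤ n →
      ∀ I : V → Set unitInterval, (∀ v, MeasurableSet (I v)) →
      (∀ v, some v ∉ P ∪ C → I v = lowThresholds (M.resistance B R v P)) →
      (volume : Measure (V → unitInterval)).real (Set.univ.pi I ∩ E (P ∪ C)) =
        (∏ v, (volume : Measure unitInterval).real (I v)) *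
          ∑ X, M.cascadeProb B n P C X * val X := by
  intro n
  -- The box `I` is what has been revealed: an inactive user has resisted `P`, so its threshold is
  -- at most its resistance to `P`, while those of active users are unconstrained. Every effective
  -- step activates someone, so the number of inactive users bounds the steps still needed.
  induction n with
  | zero =>
    intro P C hR hPC hnone hn I hI hIP
    have hall : ∀ v, some v ∈ P ∪ C := fun v => by
      have := Finset.card_eq_zero.1 (Nat.le_zero.1 hn)
      rw [Finset.compl_eq_empty_iff] at this
      exact mem_usersOf.1 (this ▸ Finset.mem_univ v)
    rw [hval (P ∪ C) (hR.trans Finset.subset_union_left) hnone I hI fun v hv => (hv (hall v)).elim]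
    simp [cascadeProb_zero]
  | succ n ih =>
    intro P C hR hPC hnone hn I hI hIP
    set Q := P ∪ C with hQ
    have hRQ : R ⊆ Q := hR.trans Finset.subset_union_left
    have hle : ∀ v, M.resistance B R v Q ≤ M.resistance B R v P := fun v =>
      resistance_antitone B R v Finset.subset_union_left
    -- the thresholds for which exactly the users in `N` become active
    let J : Finset V → V → Set unitInterval := fun N v =>
      if v ∈ N then I v \ lowThresholds (M.resistance B R v Q) else
        if some v ∈ Q then I v else lowThresholds (M.resistance B R v Q)
    have hJm : ∀ N v, MeasurableSet (J N v) := fun N v => by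
      simp only [J]
      split_ifs
      · exact (hI v).diff (measurableSet_lowThresholds _)
      · exact hI v
      · exact measurableSet_lowThresholds _
    have hJle : ∀ N, ∀ v ∉ N, some v ∉ Q → J N v = lowThresholds (M.resistance B R v Q) :=
      fun N v h1 h2 => by simp [J, h1, h2]
    have hJlt : ∀ N θ, θ ∈ Set.univ.pi (J N) → ∀ v ∈ N, M.resistance B R v Q < θ v :=
      fun N θ hθ v hv => by
        have := hθ v (Set.mem_univ v)
        simp only [J, hv, if_true] at this
        exact not_le.1 this.2
    -- For an inactive user the interval of length `r` is cut at `r * (1 - activationProb)`; the two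
    -- pieces give the two kinds of factors of `stepProb`.
    have hJvol : ∀ N ∈ ((usersOf Q)ᶜ).powerset,
        ∏ v, (volume : Measure unitInterval).real (J N v) =
          (∏ v, (volume : Measure unitInterval).real (I v)) * M.stepProb B P C N := by
      intro N hN
      rw [Finset.mem_powerset] at hN
      rw [stepProb_eq_prod B P C N, ← hQ, ← Finset.prod_mul_distrib]
      refine Finset.prod_congr rfl fun v _ => ?_
      have hun := resistance_union (M := M) B hR hPC v
      rw [← hQ] at hun
      by_cases hvN : v ∈ N
      · have hvQ : some v ∉ Q := by simpa using hN hvN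
        simp only [J, hvN, if_true, hIP v hvQ]
        rw [volume_real_lowThresholds_diff (resistance_mem_Icc B R v Q)
          (resistance_mem_Icc B R v P) (hle v), volume_real_lowThresholds
          (resistance_mem_Icc B R v P), hun]
        ring
      · by_cases hvQ : some v ∈ Q
        · simp only [J, hvN, hvQ, if_true, if_false, mul_one]
        · simp only [J, hvN, hvQ, if_false, hIP v hvQ]
          rw [volume_real_lowThresholds (resistance_mem_Icc B R v Q),
            volume_real_lowThresholds (resistance_mem_Icc B R v P), hun]
    -- Classify the thresholds by the set `N` of inactive users who now pass; `hinv` permits adding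
    -- `N` to the active set in the event.
    have hunion : Set.univ.pi I ∩ E Q =
        ⋃ N ∈ ((usersOf Q)ᶜ).powerset, Set.univ.pi (J N) ∩ E (Q ∪ N.image some) := by
      ext θ
      simp only [Set.mem_iUnion, exists_prop]
      constructor
      · rintro ⟨hθ, hθE⟩
        classical
        let N : Finset V := (usersOf Q)ᶜ.filter fun v => M.resistance B R v Q < θ v
        have hNmem : ∀ v, v ∈ N ↔ some v ∉ Q ∧ M.resistance B R v Q < θ v := fun v => by
          simp [N]
        refine ⟨N, Finset.mem_powerset.2 (Finset.filter_subset _ _), fun v _ => ?_,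
          (hinv Q N θ fun v hv => ((hNmem v).1 hv).2).2 hθE⟩
        have hθv := hθ v (Set.mem_univ v)
        by_cases hvQ : some v ∈ Q
        · simpa [J, hNmem, hvQ] using hθv
        · by_cases hv : M.resistance B R v Q < θ v
          · simp [J, hNmem, hvQ, hv, hθv]
          · simpa [J, hNmem, hvQ, hv] using not_lt.1 hv
      · rintro ⟨N, hN, hθ, hθE⟩
        rw [Finset.mem_powerset] at hN
        refine ⟨fun v _ => ?_, (hinv Q N θ (hJlt N θ hθ)).1 hθE⟩
        have hθv := hθ v (Set.mem_univ v)
        by_cases hvN : v ∈ N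
        · simp only [J, hvN, if_true] at hθv
          exact hθv.1
        · by_cases hvQ : some v ∈ Q
          · simpa [J, hvN, hvQ] using hθv
          · rw [hJle N v hvN hvQ] at hθv
            rw [hIP v hvQ]
            exact le_trans hθv (hle v)
    have hdisj : Set.PairwiseDisjoint (↑((usersOf Q)ᶜ).powerset : Set (Finset V))
        fun N => Set.univ.pi (J N) ∩ E (Q ∪ N.image some) := by
      intro N hN N' hN' hne
      rw [Finset.mem_coe, Finset.mem_powerset] at hN hN'
      refine Set.disjoint_left.2 fun θ hθ hθ' => hne ?_
      have key : ∀ {N N' : Finset V}, N ⊆ (usersOf Q)ᶜ → θ ∈ Set.univ.pi (J N) →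
          θ ∈ Set.univ.pi (J N') → N ⊆ N' := by
        intro N N' hN h1 h2 v hv
        by_contra hv'
        have h3 := h2 v (Set.mem_univ v)
        rw [hJle N' v hv' (by simpa using hN hv)] at h3
        exact absurd (hJlt N θ h1 v hv) (not_lt.2 h3)
      exact (key hN hθ.1 hθ'.1).antisymm (key hN' hθ'.1 hθ.1)
    rw [hunion, measureReal_biUnion_finset hdisj fun N _ =>
      (MeasurableSet.univ_pi (hJm N)).inter (hE _)]
    have hterm : ∀ N ∈ ((usersOf Q)ᶜ).powerset,
        (volume : Measure (V → unitInterval)).real (Set.univ.pi (J N) ∩ E (Q ∪ N.image some)) =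
        (∏ v, (volume : Measure unitInterval).real (J N v)) *
          ∑ X, M.cascadeProb B n Q (N.image some) X * val X := by
      intro N hN
      rw [Finset.mem_powerset] at hN
      -- If nobody is activated, the number of inactive users does not drop and the induction
      -- hypothesis is unavailable; but the cascade is over, and `hval` evaluates the event.
      rcases N.eq_empty_or_nonempty with rfl | ⟨v, hv⟩
      · simp only [Finset.image_empty, Finset.union_empty, cascadeProb_empty]
        rw [hval Q hRQ hnone (J ∅) (hJm ∅) fun v hv => hJle ∅ v (by simp) hv]
        simp
      · refine ih Q (N.image some) hRQ ?_ (Finset.mem_union_left _ hnone) ?_ (J N) (hJm N) ?_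
        · refine Finset.disjoint_right.2 fun x hx => ?_
          obtain ⟨u, hu, rfl⟩ := Finset.mem_image.1 hx
          simpa using hN hu
        · refine Nat.le_of_lt_succ (lt_of_lt_of_le (Finset.card_lt_card ?_) hn)
          refine Finset.ssubset_iff_of_subset ?_ |>.2 ⟨v, hN hv, by simp [hv]⟩
          exact Finset.compl_subset_compl.2 (usersOf_mono Finset.subset_union_left)
        · intro u hu
          simp only [Finset.mem_union, Finset.mem_image, Option.some.injEq, exists_eq_right,
            not_or] at hu
          exact hJle N u hu.2 hu.1
    rw [Finset.sum_congr rfl fun N hN => (hterm N hN).trans (by rw [hJvol N hN])]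
    simp only [cascadeProb, activeUsers_eq_usersOf, Finset.sum_mul, ← hQ]
    rw [Finset.sum_comm, Finset.mul_sum]
    refine Finset.sum_congr rfl fun N _ => ?_
    rw [Finset.mul_sum, Finset.mul_sum]
    refine Finset.sum_congr rfl fun X _ => ?_
    ring

end DecreasingCascade
end

noncomputable section

/-! ### Expectations of functions of random variables with finitely many values -/

theorem integrable_comp_of_fintype {Ω ι : Type*} [MeasurableSpace Ω] (μ : Measure Ω)
    [IsFiniteMeasure μ] [Finite ι] {g : Ω → ι} (hg : ∀ i, MeasurableSet {ω | g ω = i})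
    (φ : ι → ℝ) : Integrable (fun ω => φ (g ω)) μ := by
  let _ : MeasurableSpace ι := ⊤
  have : DiscreteMeasurableSpace ι := ⟨fun _ => trivial⟩
  have hgm : Measurable g := measurable_to_countable' hg
  exact (Integrable.of_finite (μ := μ.map g) (f := φ)).comp_measurable hgm

theorem sum_measureReal_mul_eq_integral {Ω ι : Type*} [MeasurableSpace Ω] (μ : Measure Ω)
    [IsFiniteMeasure μ] [Fintype ι] {g : Ω → ι} (hg : ∀ i, MeasurableSet {ω | g ω = i})
    (φ : ι → ℝ) : ∑ i, μ.real {ω | g ω = i} * φ i = ∫ ω, φ (g ω) ∂μ := by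
  classical
  let _ : MeasurableSpace ι := ⊤
  have : DiscreteMeasurableSpace ι := ⟨fun _ => trivial⟩
  have hgm : Measurable g := measurable_to_countable' hg
  rw [← integral_map (f := φ) hgm.aemeasurable (by fun_prop), integral_fintype .of_finite]
  refine Finset.sum_congr rfl fun i _ => ?_
  rw [map_measureReal_apply hgm (MeasurableSet.singleton i), smul_eq_mul]
  rfl

/-- The set of active nodes when `u₀` and the users in `X` are active. -/
def activeNodes {V : Type*} [DecidableEq V] (X : Finset V) : Finset (Option V) :=
  insert none (X.image some)

section ActiveNodes

variable {V : Type*} [DecidableEq V] {X Y : Finset V}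

@[simp]
theorem none_mem_activeNodes : none ∈ activeNodes X := by simp [activeNodes]

@[simp]
theorem some_mem_activeNodes {v : V} : some v ∈ activeNodes X ↔ v ∈ X := by simp [activeNodes]

theorem activeNodes_mono (h : X ⊆ Y) : activeNodes X ⊆ activeNodes Y :=
  Finset.insert_subset_insert _ (Finset.image_subset_image h)

variable [Fintype V]

theorem activeNodes_usersOf {A : Finset (Option V)} (hA : none ∈ A) :
    activeNodes (usersOf A) = A := by
  ext x
  rcases x with _ | v <;> simp [hA]

end ActiveNodes

/-! ### Law of the final set, also for a cascade restarted midway -/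

namespace DecreasingCascade

variable {V : Type*} [Fintype V] [DecidableEq V] {M : DecreasingCascade V}

theorem measurableSet_usersOf_thresholdClosure (h : V → Finset (Option V) → ℝ)
    (A : Finset (Option V)) (F : Finset V) :
    MeasurableSet {θ : V → unitInterval | usersOf (thresholdClosure h θ A) = F} :=
  measurableSet_thresholdClosure h A fun D => usersOf D = F

/-- If no further user passes its threshold, the process has stopped. -/
theorem univ_pi_inter_closure {h : V → Finset (Option V) → ℝ} {P : Finset (Option V)}
    {I : V → Set unitInterval} (hI : ∀ v, some v ∉ P → I v ⊆ lowThresholds (h v P))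
    (F : Finset V) :
    (volume : Measure (V → unitInterval)).real
      (Set.univ.pi I ∩ {θ | usersOf (thresholdClosure h θ P) = F}) =
    (∏ v, (volume : Measure unitInterval).real (I v)) * if usersOf P = F then 1 else 0 := by
  have hcl : ∀ θ ∈ Set.univ.pi I, thresholdClosure h θ P = P := fun θ hθ =>
    IsThresholdClosed.closure_eq fun v hv => by
      by_contra hvP
      exact absurd hv (not_lt.2 (hI v hvP (hθ v (Set.mem_univ v))))
  split_ifs with hF
  · rw [mul_one, ← volume_real_univ_pi]
    congr 1
    ext θ
    refine ⟨fun hθ => hθ.1, fun hθ => ⟨hθ, ?_⟩⟩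
    simpa [hcl θ hθ] using hF
  · have : Set.univ.pi I ∩ {θ | usersOf (thresholdClosure h θ P) = F} = ∅ := by
      refine Set.eq_empty_of_forall_notMem fun θ hθ => hF ?_
      have h2 := hθ.2
      simpa [hcl θ hθ.1] using h2
    rw [this, mul_zero, measureReal_empty]

theorem volume_real_inter_closure (B : Finset V) {R P C : Finset (Option V)} (hR : R ⊆ P)
    (hPC : Disjoint P C) (hnone : none ∈ P ∪ C) {n : ℕ} (hn : (usersOf (P ∪ C))ᶜ.card ≤ n)
    {I : V → Set unitInterval} (hI : ∀ v, MeasurableSet (I v))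
    (hIP : ∀ v, some v ∉ P ∪ C → I v = lowThresholds (M.resistance B R v P)) (F : Finset V) :
    (volume : Measure (V → unitInterval)).real
      (Set.univ.pi I ∩ {θ | usersOf (thresholdClosure (M.resistance B R) θ (P ∪ C)) = F}) =
    (∏ v, (volume : Measure unitInterval).real (I v)) * M.cascadeProb B n P C F := by
  have := volume_real_eq_sum_cascadeProb (M := M) B R
    (fun A => {θ | usersOf (thresholdClosure (M.resistance B R) θ A) = F})
    (fun A => measurableSet_usersOf_thresholdClosure _ A F)
    (fun A N θ hN => by
      simp [thresholdClosure_union_image (resistance_antitone B R) hN])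
    (fun X => if X = F then 1 else 0)
    (fun P _ _ I _ hIP => univ_pi_inter_closure (fun v hv => (hIP v hv).le) F)
    n P C hR hPC hnone hn I hI hIP
  rw [this]
  simp

/-- The law of the cascade is the law of a threshold process. -/
theorem cascadeProb_eq_volume_real (B : Finset V) {P C : Finset (Option V)}
    (hPC : Disjoint P C) (hnone : none ∈ P ∪ C) {n : ℕ} (hn : (usersOf (P ∪ C))ᶜ.card ≤ n)
    (F : Finset V) :
    M.cascadeProb B n P C F = (volume : Measure (V → unitInterval)).real
      {θ | usersOf (thresholdClosure (M.resistance B P) θ (P ∪ C)) = F} := by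
  -- Taking `R = P` makes every resistance to `P` equal to 1, so the box is the whole cube:
  -- conditioning on the past failures amounts to drawing fresh thresholds.
  have := volume_real_inter_closure (M := M) B subset_rfl hPC hnone hn (I := fun _ => Set.univ)
    (fun _ => MeasurableSet.univ) (fun v _ => by
      ext x
      simpa using x.2.2) F
  simpa using this.symm

/-- The users who retweet when the followers of `u₀` are the users in `B`, as a function of the
thresholds. -/
def thresholdRetweeters (M : DecreasingCascade V) (B : Finset V) (θ : V → unitInterval) :
    Finset V :=
  usersOf (thresholdClosure (M.resistance B ∅) θ {none})

theorem retweetersProb_eq_volume_real (B F : Finset V) :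
    M.retweetersProb B F = (volume : Measure (V → unitInterval)).real
      {θ | M.thresholdRetweeters B θ = F} := by
  have := cascadeProb_eq_volume_real (M := M) B (P := ∅) (C := {none}) (by simp) (by simp)
    (Finset.card_le_univ _) F
  simpa [retweetersProb, thresholdRetweeters] using this

/-- More followers only lower the resistances, so with the same thresholds a set closed for `B'` is
closed for `B`. -/
theorem thresholdRetweeters_mono {B B' : Finset V} (h : B ⊆ B') (θ : V → unitInterval) :
    M.thresholdRetweeters B θ ⊆ M.thresholdRetweeters B' θ :=
  usersOf_mono <| thresholdClosure_subset subset_thresholdClosure fun v hv =>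
    isThresholdClosed_thresholdClosure (resistance_antitone B' ∅) v
      ((resistance_le_of_subset h v _).trans_lt hv)

theorem sum_retweetersProb_mul (B : Finset V) (φ : Finset V → ℝ) :
    ∑ X, M.retweetersProb B X * φ X = ∫ θ, φ (M.thresholdRetweeters B θ) := by
  simp only [retweetersProb_eq_volume_real]
  exact sum_measureReal_mul_eq_integral _
    (fun F => measurableSet_usersOf_thresholdClosure _ _ F) φ

theorem integrable_thresholdRetweeters (B : Finset V) (φ : Finset V → ℝ) :
    Integrable fun θ => φ (M.thresholdRetweeters B θ) :=
  integrable_comp_of_fintype _ (fun F => measurableSet_usersOf_thresholdClosure _ _ F) φ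

/-! ### Postponing the attempt of `u₀` on an additional follower -/

variable (M)

/-- The probability that an additional follower `w` of `u₀` becomes active by an attempt of `u₀`,
after the users in `X` have been active. -/
def lateProb (B : Finset V) (w : V) (X : Finset V) : ℝ :=
  M.p w none (activeNodes X ∩ M.senders B w)

/-- The law of the set of users who retweet in the end when `u₀` makes its attempt on an additional
follower `w` after the cascade has stopped with the active users `X`. -/
def lateCascadeProb (B : Finset V) (w : V) (X F : Finset V) : ℝ :=
  if w ∈ X then if X = F then 1 else 0
  else (1 - M.lateProb B w X) * (if X = F then 1 else 0) +
    M.lateProb B w X *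
      M.cascadeProb (insert w B) (Fintype.card V) (activeNodes X) {some w} F

variable {M}

theorem lateProb_mem_Icc {B : Finset V} {w : V} (hw : w ∉ B) (X : Finset V) :
    M.lateProb B w X ∈ Set.Icc (0 : ℝ) 1 :=
  M.p_mem w _ (Finset.inter_subset_right.trans (senders_subset B w)) none
    (none_mem_potentialSenders w) (by simp [none_mem_senders, hw])

theorem lateProb_anti {B B' : Finset V} (hB : B ⊆ B') {w : V} (hw : w ∉ B') {X Y : Finset V}
    (hXY : X ⊆ Y) : M.lateProb B' w Y ≤ M.lateProb B w X :=
  M.decreasing w _ (Finset.inter_subset_right.trans (senders_subset B' w)) _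
    (Finset.inter_subset_inter (activeNodes_mono hXY) (senders_mono hB w)) none
    (none_mem_potentialSenders w) (by simp [none_mem_senders, hw])

theorem prod_volume_real_update (I : V → Set unitInterval) (w : V) (s : Set unitInterval) :
    ∏ v, (volume : Measure unitInterval).real (Function.update I w s v) =
      (volume : Measure unitInterval).real s *
        ∏ v ∈ Finset.univ.erase w, (volume : Measure unitInterval).real (I v) := by
  rw [← Finset.mul_prod_erase _ _ (Finset.mem_univ w), Function.update_self]
  congr 1
  exact Finset.prod_congr rfl fun v hv => by
    rw [Function.update_of_ne (Finset.ne_of_mem_erase hv)]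

/-- By order independence, `u₀` may wait until the end of the cascade before its attempt on an
additional follower. -/
theorem retweetersProb_insert {B : Finset V} {w : V} (hw : w ∉ B) (F : Finset V) :
    M.retweetersProb (insert w B) F =
      ∑ X, M.retweetersProb B X * M.lateCascadeProb B w X F := by
  have hle : ∀ v A, M.resistance (insert w B) ∅ v A ≤ M.resistance B ∅ v A := fun v A =>
    resistance_le_of_subset (Finset.subset_insert w B) v A
  -- The cascade is run with the followers `B`, but the event concerns the closure for `insert w B`.
  -- Users who pass against the former resistance also pass against the latter, which is the
  -- required invariance.
  have := volume_real_eq_sum_cascadeProb (M := M) B ∅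
    (fun A => {θ | usersOf (thresholdClosure (M.resistance (insert w B) ∅) θ A) = F})
    (fun A => measurableSet_usersOf_thresholdClosure _ A F)
    (fun A N θ hN => by
      simp [thresholdClosure_union_image (resistance_antitone (insert w B) ∅)
        fun v hv => (hle v A).trans_lt (hN v hv)])
    (fun X => M.lateCascadeProb B w X F) ?_
    (Fintype.card V) ∅ {none} subset_rfl (by simp) (by simp) (Finset.card_le_univ _)
    (fun _ => Set.univ) (fun _ => MeasurableSet.univ) (fun v _ => by
      ext x
      simpa using x.2.2)
  · rw [retweetersProb_eq_volume_real]
    simpa [thresholdRetweeters, retweetersProb] using this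
  · intro P _ hnone I hI hIP
    -- The cascade for `B` has stopped at `P`. The extra attempt affects the resistance of `w`
    -- alone, so if `w` is already active, nothing more happens.
    by_cases hwP : some w ∈ P
    · rw [lateCascadeProb, if_pos (by simpa using hwP)]
      refine univ_pi_inter_closure (fun v hv => ?_) F
      rw [resistance_insert_of_ne (by rintro rfl; exact hv hwP), hIP v hv]
    · rw [lateCascadeProb, if_neg (by simpa using hwP), activeNodes_usersOf hnone, lateProb,
        activeNodes_usersOf hnone]
      set q := M.p w none (P ∩ M.senders B w)
      set a := M.resistance (insert w B) ∅ w P with ha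
      have hab : a = M.resistance B ∅ w P * (1 - q) := resistance_insert_self hw hnone
      have hIw := hIP w hwP
      -- The threshold interval of `w` is cut at `a`: below it `w` resists the late attempt of `u₀`,
      -- above it `w` yields, with conditional probability `q`.
      let I₁ := Function.update I w (lowThresholds a)
      let I₂ := Function.update I w (I w \ lowThresholds a)
      have hI₁ : ∀ v, v ≠ w → I₁ v = I v := fun v hv => Function.update_of_ne hv _ _
      have hI₂ : ∀ v, v ≠ w → I₂ v = I v := fun v hv => Function.update_of_ne hv _ _
      have hI₁w : I₁ w = lowThresholds a := Function.update_self _ _ _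
      have hI₂w : I₂ w = I w \ lowThresholds a := Function.update_self _ _ _
      have hI₂m : ∀ v, MeasurableSet (I₂ v) := fun v => by
        by_cases hv : v = w
        · subst hv
          rw [hI₂w]
          exact (hI v).diff (measurableSet_lowThresholds _)
        · rw [hI₂ v hv]
          exact hI v
      have hsplit : Set.univ.pi I = Set.univ.pi I₁ ∪ Set.univ.pi I₂ := by
        ext θ
        simp only [Set.mem_univ_pi, Set.mem_union]
        constructor
        · intro hθ
          by_cases h : θ w ∈ lowThresholds a
          · left
            intro v
            by_cases hv : v = w
            · subst hv
              rwa [hI₁w]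
            · rw [hI₁ v hv]
              exact hθ v
          · right
            intro v
            by_cases hv : v = w
            · subst hv
              rw [hI₂w]
              exact ⟨hθ v, h⟩
            · rw [hI₂ v hv]
              exact hθ v
        · rintro (hθ | hθ) v
          · by_cases hv : v = w
            · subst hv
              have := hθ v
              rw [hI₁w] at this
              rw [hIw]
              exact le_trans this (hle v P)
            · rw [← hI₁ v hv]
              exact hθ v
          · by_cases hv : v = w
            · subst hv
              have := hθ v
              rw [hI₂w] at this
              exact this.1
            · rw [← hI₂ v hv]
              exact hθ v
      have hdisj : Disjoint (Set.univ.pi I₁) (Set.univ.pi I₂) :=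
        Set.disjoint_left.2 fun θ h1 h2 => by
          have h1w := h1 w (Set.mem_univ w)
          have h2w := h2 w (Set.mem_univ w)
          rw [hI₁w] at h1w
          rw [hI₂w] at h2w
          exact h2w.2 h1w
      have hlow : ∀ v, some v ∉ P → v ≠ w →
          I v = lowThresholds (M.resistance (insert w B) ∅ v P) := fun v hv hvw => by
        rw [resistance_insert_of_ne hvw, hIP v hv]
      have hhalt := univ_pi_inter_closure (h := M.resistance (insert w B) ∅) (P := P) (I := I₁)
        (fun v hv => by
          by_cases hvw : v = w
          · subst hvw
            rw [hI₁w]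
          · rw [hI₁ v hvw, hlow v hv hvw]) F
      -- In the restart `w` counts as active, so its threshold may be confined to an arbitrary
      -- measurable set, here the slice above `a`.
      have hgo := volume_real_inter_closure (M := M) (insert w B) (Finset.empty_subset P)
        (C := {some w}) (by simpa using hwP) (by simp [hnone]) (Finset.card_le_univ _)
        (I := I₂) hI₂m (fun v hv => by
          simp only [Finset.mem_union, Finset.mem_singleton, Option.some.injEq, not_or] at hv
          rw [hI₂ v hv.2, hlow v hv.1 hv.2]) F
      have hE₂ : Set.univ.pi I₂ ∩
            {θ | usersOf (thresholdClosure (M.resistance (insert w B) ∅) θ P) = F} =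
          Set.univ.pi I₂ ∩ {θ | usersOf
            (thresholdClosure (M.resistance (insert w B) ∅) θ (P ∪ {some w})) = F} := by
        ext θ
        refine and_congr_right fun hθ => ?_
        have hcl := thresholdClosure_union_image (A := P) (θ := θ)
          (resistance_antitone (M := M) (insert w B) ∅) (N := {w}) (fun v hv => by
            rw [Finset.mem_singleton.1 hv]
            have := hθ w (Set.mem_univ w)
            rw [hI₂w] at this
            exact not_le.1 this.2)
        rw [Finset.image_singleton] at hcl
        simp only [Set.mem_ofPred_eq, hcl]
      rw [hsplit, Set.union_inter_distrib_right, measureReal_union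
        (hdisj.mono Set.inter_subset_left Set.inter_subset_left)
        ((MeasurableSet.univ_pi hI₂m).inter (measurableSet_usersOf_thresholdClosure _ _ F)),
        hE₂, hhalt, hgo, prod_volume_real_update, prod_volume_real_update,
        ← Finset.mul_prod_erase _ _ (Finset.mem_univ w), hIw,
        volume_real_lowThresholds_diff (resistance_mem_Icc _ _ _ _) (resistance_mem_Icc _ _ _ _)
          (hle w P),
        volume_real_lowThresholds (resistance_mem_Icc _ _ _ _),
        volume_real_lowThresholds (resistance_mem_Icc _ _ _ _), ← ha, hab]
      ring

/-! ### Monotonicity and submodularity -/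

variable (M)

/-- The users who retweet in the end when the cascade restarts with the contagious user `w`, after
it has stopped with the active users `X`, as a function of fresh thresholds. -/
def restartedUsers (B : Finset V) (w : V) (X : Finset V) (θ : V → unitInterval) : Finset V :=
  usersOf (thresholdClosure (M.resistance (insert w B) (activeNodes X)) θ
    (activeNodes X ∪ {some w}))

/-- The expected number of additional retweets due to an additional follower `w`, after the cascade
has stopped with the active users `X`. -/
def lateGain (B : Finset V) (w : V) (X : Finset V) : ℝ :=
  if w ∈ X then 0
  else M.lateProb B w X * ∫ θ, (((M.restartedUsers B w X θ \ X).card : ℕ) : ℝ)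

variable {M}

theorem measurableSet_restartedUsers (B : Finset V) (w : V) (X F : Finset V) :
    MeasurableSet {θ | M.restartedUsers B w X θ = F} :=
  measurableSet_usersOf_thresholdClosure _ _ F

theorem subset_restartedUsers (B : Finset V) (w : V) (X : Finset V) (θ : V → unitInterval) :
    X ⊆ M.restartedUsers B w X θ := fun v hv => by
  rw [restartedUsers, mem_usersOf]
  exact subset_thresholdClosure (by simp [hv])

/-- The users in `X` stay active whatever happens; only the surplus of a successful restart has to
be averaged, and its law is that of fresh thresholds. -/
theorem sum_lateCascadeProb_mul_card (B : Finset V) (w : V) (X : Finset V) :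
    ∑ F, M.lateCascadeProb B w X F * (F.card : ℝ) = X.card + M.lateGain B w X := by
  unfold lateCascadeProb lateGain
  by_cases hw : w ∈ X
  · simp [hw]
  · have h1 : ∑ F, M.cascadeProb (insert w B) (Fintype.card V) (activeNodes X) {some w} F *
        (F.card : ℝ) = X.card + ∫ θ, (((M.restartedUsers B w X θ \ X).card : ℕ) : ℝ) := by
      have h2 : ∀ F, M.cascadeProb (insert w B) (Fintype.card V) (activeNodes X) {some w} F =
          (volume : Measure (V → unitInterval)).real {θ | M.restartedUsers B w X θ = F} :=
        fun F => cascadeProb_eq_volume_real (insert w B) (by simpa using hw) (by simp)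
          (Finset.card_le_univ _) F
      simp only [h2]
      rw [sum_measureReal_mul_eq_integral _ (measurableSet_restartedUsers B w X)
        (fun F => (F.card : ℝ))]
      have h3 : ∀ θ, ((M.restartedUsers B w X θ).card : ℝ) =
          X.card + (((M.restartedUsers B w X θ \ X).card : ℕ) : ℝ) := fun θ => by
        rw [← Finset.card_sdiff_add_card_eq_card (subset_restartedUsers B w X θ)]
        push_cast
        ring
      simp only [h3]
      rw [integral_add (integrable_const _) (integrable_comp_of_fintype _
        (measurableSet_restartedUsers B w X) fun F => (((F \ X).card : ℕ) : ℝ))]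
      simp
    simp only [if_neg hw, add_mul, Finset.sum_add_distrib, mul_assoc]
    rw [← Finset.mul_sum, ← Finset.mul_sum, h1]
    simp
    ring

theorem expectedRetweets_eq_integral (B : Finset V) :
    M.expectedRetweets B = ∫ θ, ((M.thresholdRetweeters B θ).card : ℝ) :=
  sum_retweetersProb_mul B fun F => (F.card : ℝ)

/-- Writes a marginal increase as an average over the threshold process for `B` alone, which can be
coupled with the one for a larger set. -/
theorem expectedRetweets_insert_sub {B : Finset V} {w : V} (hw : w ∉ B) :
    M.expectedRetweets (insert w B) - M.expectedRetweets B =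
      ∫ θ, M.lateGain B w (M.thresholdRetweeters B θ) := by
  rw [← sum_retweetersProb_mul B (M.lateGain B w)]
  simp only [expectedRetweets, retweetersProb_insert hw, Finset.sum_mul]
  rw [Finset.sum_comm, ← Finset.sum_sub_distrib]
  refine Finset.sum_congr rfl fun X _ => ?_
  simp only [mul_assoc]
  rw [← Finset.mul_sum, sum_lateCascadeProb_mul_card]
  ring

theorem expectedRetweets_nonneg (B : Finset V) : 0 ≤ M.expectedRetweets B := by
  rw [expectedRetweets_eq_integral]
  exact integral_nonneg fun θ => Nat.cast_nonneg _

theorem expectedRetweets_mono {B B' : Finset V} (h : B ⊆ B') :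
    M.expectedRetweets B ≤ M.expectedRetweets B' := by
  simp only [expectedRetweets_eq_integral]
  exact integral_mono (integrable_thresholdRetweeters B fun F => (F.card : ℝ))
    (integrable_thresholdRetweeters B' fun F => (F.card : ℝ)) fun θ =>
      Nat.cast_le.2 (Finset.card_le_card (thresholdRetweeters_mono h θ))

/-- With common fresh thresholds, let `D` be the closure for the smaller state. A user outside `Y`
and `D` faces, in the larger state, fewer new attempts and after more failures, hence resists at
least as well as against `D`. So `activeNodes Y ∪ D` is closed. -/
theorem restartedUsers_sdiff_subset {B B' : Finset V} (hB : B ⊆ B') (w : V) {X Y : Finset V}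
    (hXY : X ⊆ Y) (θ : V → unitInterval) :
    M.restartedUsers B' w Y θ \ Y ⊆ M.restartedUsers B w X θ \ X := by
  set D := thresholdClosure (M.resistance (insert w B) (activeNodes X)) θ
    (activeNodes X ∪ {some w}) with hD
  have hwD : some w ∈ D := subset_thresholdClosure (by simp)
  have hclosed : IsThresholdClosed (M.resistance (insert w B') (activeNodes Y)) θ
      (activeNodes Y ∪ D) := by
    intro v hv
    by_contra hvD
    rw [Finset.mem_union, not_or] at hvD
    have hvw : v ≠ w := fun e => hvD.2 (e ▸ hwD)
    refine hvD.2 (isThresholdClosed_thresholdClosure (resistance_antitone _ _) v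
      (lt_of_le_of_lt ?_ hv))
    rw [← hD]
    have hs := senders_mono (M := M) (Finset.insert_subset_insert w hB) v
    have hp := senders_subset (M := M) (insert w B) v
    have hp' := senders_subset (M := M) (insert w B') v
    refine (resist_anti_right (L' := ((activeNodes Y ∪ D) \ activeNodes Y) ∩
      M.senders (insert w B') v) ?_ (Finset.inter_subset_right.trans hp)
      (Finset.inter_subset_right.trans hp) (disjoint_inter_sdiff_inter _ _ _)).trans
      (resist_mono_left (Finset.inter_subset_inter (activeNodes_mono hXY) hs)
        (Finset.inter_subset_right.trans hp') (Finset.inter_subset_right.trans hp')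
        (disjoint_inter_sdiff_inter _ _ _))
    intro x hx
    simp only [Finset.mem_inter, Finset.mem_sdiff, Finset.mem_union] at hx ⊢
    -- The attempt of `u₀` belongs to the past; all other senders come from the graph and do not
    -- depend on the set of followers.
    rcases x with _ | u
    · exact absurd none_mem_activeNodes hx.1.2
    · refine ⟨⟨hx.1.1.resolve_left hx.1.2, fun h => hx.1.2 (activeNodes_mono hXY h)⟩, ?_⟩
      rw [some_mem_senders]
      exact hp' hx.2
  have hsub : thresholdClosure (M.resistance (insert w B') (activeNodes Y)) θ
      (activeNodes Y ∪ {some w}) ⊆ activeNodes Y ∪ D :=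
    thresholdClosure_subset (Finset.union_subset_union_right (by simpa using hwD)) hclosed
  intro v hv
  simp only [restartedUsers, Finset.mem_sdiff, mem_usersOf] at hv ⊢
  have := hsub hv.1
  rw [Finset.mem_union, some_mem_activeNodes] at this
  exact ⟨this.resolve_left hv.2, fun h => hv.2 (hXY h)⟩

/-- Both factors decrease: the success probability by `decreasing`, the surplus of the restart by
the coupling with common thresholds. -/
theorem lateGain_anti {B B' : Finset V} (hB : B ⊆ B') {w : V} (hw : w ∉ B') {X Y : Finset V}
    (hXY : X ⊆ Y) : M.lateGain B' w Y ≤ M.lateGain B w X := by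
  have hint : ∀ B X, 0 ≤ ∫ θ, (((M.restartedUsers B w X θ \ X).card : ℕ) : ℝ) := fun B X =>
    integral_nonneg fun θ => Nat.cast_nonneg _
  have hX := lateProb_mem_Icc (M := M) (fun h => hw (hB h)) X
  have hY := lateProb_mem_Icc (M := M) hw Y
  unfold lateGain
  by_cases hwY : w ∈ Y
  · rw [if_pos hwY]
    split_ifs
    · exact le_rfl
    · exact mul_nonneg hX.1 (hint B X)
  · rw [if_neg hwY, if_neg fun h => hwY (hXY h)]
    refine mul_le_mul (lateProb_anti hB hw hXY) ?_ (hint B' Y) hX.1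
    refine integral_mono
      (integrable_comp_of_fintype _ (measurableSet_restartedUsers B' w Y)
        fun F => (((F \ Y).card : ℕ) : ℝ))
      (integrable_comp_of_fintype _ (measurableSet_restartedUsers B w X)
        fun F => (((F \ X).card : ℕ) : ℝ)) fun θ => ?_
    exact Nat.cast_le.2 (Finset.card_le_card (restartedUsers_sdiff_subset hB w hXY θ))

/-- The expected number of retweets is a submodular function of the set of followers. -/
theorem expectedRetweets_submodular {B B' : Finset V} (hB : B ⊆ B') (w : V) :
    M.expectedRetweets (insert w B') - M.expectedRetweets B' ≤
      M.expectedRetweets (insert w B) - M.expectedRetweets B := by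
  by_cases hw : w ∈ B'
  · rw [Finset.insert_eq_of_mem hw, sub_self, sub_nonneg]
    exact expectedRetweets_mono (Finset.subset_insert w B)
  · rw [expectedRetweets_insert_sub hw, expectedRetweets_insert_sub fun h => hw (hB h)]
    -- Both gains are averaged over the same thresholds, for which the retweeters of `B` are among
    -- those of `B'`.
    exact integral_mono (integrable_thresholdRetweeters B' _)
      (integrable_thresholdRetweeters B _) fun θ =>
        lateGain_anti hB hw (thresholdRetweeters_mono hB θ)

end DecreasingCascade
end

noncomputable section

/-! ### The greedy algorithm for a submodular function -/

theorem clairvoyantGreedy_succ {V : Type*} [DecidableEq V] (pick : Finset V → Finset V → V)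
    (R : Finset V) (n : ℕ) : clairvoyantGreedy pick R (n + 1) =
      if (R \ clairvoyantGreedy pick R n).Nonempty then
        insert (pick (clairvoyantGreedy pick R n) (R \ clairvoyantGreedy pick R n))
          (clairvoyantGreedy pick R n)
      else clairvoyantGreedy pick R n := rfl

/-- A submodular function increases on `O` by at most the sum of the marginal increases. -/
theorem le_add_sum_of_submodular {V : Type*} [DecidableEq V] {f : Finset V → ℝ}
    (hsub : ∀ B B' : Finset V, B ⊆ B' → ∀ w, f (insert w B') - f B' ≤ f (insert w B) - f B)
    (B O : Finset V) : f (B ∪ O) ≤ f B + ∑ w ∈ O, (f (insert w B) - f B) := by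
  induction O using Finset.induction_on with
  | empty => simp
  | insert w O hw ih =>
    rw [Finset.sum_insert hw, Finset.union_insert]
    have := hsub B (B ∪ O) Finset.subset_union_left w
    linarith

/-- The Nemhauser–Wolsey–Fisher bound. -/
theorem greedy_bound {V : Type*} [DecidableEq V] {f : Finset V → ℝ}
    (hmono : ∀ B B' : Finset V, B ⊆ B' → f B ≤ f B')
    (hsub : ∀ B B' : Finset V, B ⊆ B' → ∀ w, f (insert w B') - f B' ≤ f (insert w B) - f B)
    (h0 : 0 ≤ f ∅) {pick : Finset V → Finset V → V}
    (hpick : ∀ B C : Finset V, C.Nonempty → pick B C ∈ C ∧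
      ∀ w ∈ C, f (insert w B) - f B ≤ f (insert (pick B C) B) - f B)
    {K : ℕ} {R O : Finset V} (hOR : O ⊆ R) (hO : O.card ≤ K) :
    (1 - 1 / Real.exp 1) * f O ≤ f (clairvoyantGreedy pick R K) := by
  -- The contraction factor below is `1 - 1 / K`, so `K = 0` is treated apart; then only `f ∅` is
  -- compared with itself.
  rcases Nat.eq_zero_or_pos K with rfl | hK
  · have hO' : O = ∅ := Finset.card_eq_zero.1 (Nat.le_zero.1 hO)
    subst hO'
    have : 0 ≤ 1 / Real.exp 1 := by positivity
    simp only [clairvoyantGreedy]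
    nlinarith
  have hK' : (0 : ℝ) < K := Nat.cast_pos.2 hK
  have hK1 : (1 : ℝ) / K ≤ 1 := by
    rw [div_le_one hK']
    exact_mod_cast hK
  -- The best marginal increase is at least a `1 / K` share of the gap to `f O`, because the at most
  -- `K` elements of `O` together close the gap.
  have hstep : ∀ n, f O - f (clairvoyantGreedy pick R (n + 1)) ≤
      (1 - 1 / K) * (f O - f (clairvoyantGreedy pick R n)) := by
    intro n
    set B := clairvoyantGreedy pick R n with hB
    rw [clairvoyantGreedy_succ, ← hB]
    split_ifs with hne
    · have hp := hpick B _ hne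
      set g := f (insert (pick B (R \ B)) B) - f B with hg
      have hg0 : 0 ≤ g := sub_nonneg.2 (hmono _ _ (Finset.subset_insert _ _))
      have h1 : f O ≤ f B + K * g := by
        refine (hmono _ _ Finset.subset_union_right).trans
          ((le_add_sum_of_submodular hsub B O).trans ?_)
        have : ∑ w ∈ O, (f (insert w B) - f B) ≤ ∑ _w ∈ O, g := by
          refine Finset.sum_le_sum fun w hw => ?_
          by_cases hwB : w ∈ B
          · simpa [Finset.insert_eq_of_mem hwB] using hg0
          · exact hp.2 w (Finset.mem_sdiff.2 ⟨hOR hw, hwB⟩)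
        rw [Finset.sum_const, nsmul_eq_mul] at this
        have hc : (O.card : ℝ) * g ≤ K * g :=
          mul_le_mul_of_nonneg_right (by exact_mod_cast hO) hg0
        linarith
      have h2 : (f O - f B) / K ≤ g := by
        rw [div_le_iff₀ hK']
        linarith
      have h3 : (1 - 1 / (K : ℝ)) * (f O - f B) = (f O - f B) - (f O - f B) / K := by ring
      rw [h3]
      linarith
    -- All of `R` has been taken, so `O ⊆ B` and the gap is nonpositive; a smaller multiple of it is
    -- only larger.
    · rw [Finset.not_nonempty_iff_eq_empty, Finset.sdiff_eq_empty_iff_subset] at hne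
      have h1 := hmono _ _ (hOR.trans hne)
      have h2 : 0 ≤ 1 / (K : ℝ) := by positivity
      nlinarith
  have hpow : ∀ n, f O - f (clairvoyantGreedy pick R n) ≤ (1 - 1 / K) ^ n * (f O - f ∅) := by
    intro n
    induction n with
    | zero => simp [clairvoyantGreedy]
    | succ n ih =>
      rw [pow_succ', mul_assoc]
      exact (hstep n).trans (mul_le_mul_of_nonneg_left ih (by linarith))
  have hexp : (1 - 1 / (K : ℝ)) ^ K ≤ 1 / Real.exp 1 := by
    rw [one_div (Real.exp 1), ← Real.exp_neg]
    exact Real.one_sub_div_pow_le_exp_neg (by exact_mod_cast hK)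
  have hO0 : f ∅ ≤ f O := hmono _ _ (Finset.empty_subset O)
  have h1 := hpow K
  have h2 : (1 - 1 / (K : ℝ)) ^ K * (f O - f ∅) ≤ 1 / Real.exp 1 * f O :=
    mul_le_mul hexp (by linarith) (by linarith) (by positivity)
  linarith

theorem clairvoyantGreedy_eq_of_le {V : Type*} [DecidableEq V] {pick : Finset V → Finset V → V}
    {R : Finset V} {n : ℕ} (hn : clairvoyantGreedy pick R n = R) {m : ℕ} (h : n ≤ m) :
    clairvoyantGreedy pick R m = R := by
  induction m, h using Nat.le_induction with
  | base => exact hn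
  | succ m _ ih => simp [clairvoyantGreedy_succ, ih]

end

/-! ### Schedules that agree up to a given time -/

noncomputable section

theorem SameUpTo.refl (t : ℝ≥0) (a : ℝ≥0∞) : SameUpTo t a a := Or.inl rfl

theorem SameUpTo.symm {t : ℝ≥0} {a b : ℝ≥0∞} (h : SameUpTo t a b) : SameUpTo t b a :=
  h.imp Eq.symm And.symm

theorem SameUpTo.trans {t : ℝ≥0} {a b c : ℝ≥0∞} (h : SameUpTo t a b) (h' : SameUpTo t b c) :
    SameUpTo t a c := by
  rcases h with rfl | h
  · exact h'
  · rcases h' with rfl | h'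
    · exact Or.inr h
    · exact Or.inr ⟨h.1, h'.2⟩

/-- Two schedules look the same to an observer up to time `t`. -/
def Schedule.Same {V : Type*} (t : ℝ≥0) (s s' : Schedule V) : Prop :=
  ∀ v, SameUpTo t (s.followTime v) (s'.followTime v) ∧
    SameUpTo t (s.unfollowTime v) (s'.unfollowTime v)

theorem Schedule.Same.refl {V : Type*} (t : ℝ≥0) (s : Schedule V) : s.Same t s := fun _ =>
  ⟨.refl _ _, .refl _ _⟩

theorem Schedule.Same.symm {V : Type*} {t : ℝ≥0} {s s' : Schedule V} (h : s.Same t s') :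
    s'.Same t s := fun v => ⟨(h v).1.symm, (h v).2.symm⟩

theorem Schedule.Same.trans {V : Type*} {t : ℝ≥0} {s s' s'' : Schedule V} (h : s.Same t s')
    (h' : s'.Same t s'') : s.Same t s'' := fun v =>
  ⟨(h v).1.trans (h' v).1, (h v).2.trans (h' v).2⟩

variable {V : Type*} [Fintype V] {K : ℕ} {T : ℝ≥0} {d d' : V → ℝ≥0∞}

/-! ### The result of an online algorithm -/

@[simp]
theorem mem_reciprocating {v : V} : v ∈ reciprocating T d ↔ d v ≤ T := by
  simp [reciprocating]

theorem IsOnlineAlgorithm.final_subset {A : (V → ℝ≥0∞) → Schedule V}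
    (hA : IsOnlineAlgorithm K T A) (d : V → ℝ≥0∞) : (A d).final ⊆ reciprocating T d := by
  intro v hv
  simp only [Schedule.final, Finset.mem_filter, Finset.mem_univ, true_and] at hv
  rw [mem_reciprocating]
  by_contra hd
  have := hA.drop_late d v (not_le.1 hd)
  rw [hv.2, top_le_iff, ENNReal.add_eq_top] at this
  exact this.elim hv.1 ENNReal.coe_ne_top

/-- At the latest follow time of a final user, all final users are followed simultaneously, and the
capacity applies. -/
theorem IsOnlineAlgorithm.card_final_le {A : (V → ℝ≥0∞) → Schedule V}
    (hA : IsOnlineAlgorithm K T A) (d : V → ℝ≥0∞) : (A d).final.card ≤ K := by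
  refine (Finset.card_le_card fun v hv => ?_).trans
    (hA.capacity d ((A d).final.sup fun v => ((A d).followTime v).toNNReal))
  have hv' := hv
  simp only [Schedule.final, Finset.mem_filter, Finset.mem_univ, true_and] at hv'
  simp only [Schedule.followedAt, Finset.mem_filter, Finset.mem_univ, true_and, hv'.2,
    ENNReal.coe_lt_top, and_true]
  rw [← ENNReal.coe_toNNReal hv'.1, ENNReal.coe_le_coe]
  exact Finset.le_sup (f := fun v => ((A d).followTime v).toNNReal) hv

/-! ### The practical greedy algorithm -/

namespace GreedyState

variable (V) in
/-- The state at time `0`. -/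
def init : GreedyState V where
  time := 0
  kept := ∅
  tried := ∅
  schedule := { followTime := fun _ => ⊤, unfollowTime := fun _ => ⊤ }

/-- The facts that hold in all states that the algorithm reaches. -/
structure IsValid (K : ℕ) (T : ℝ≥0) (d : V → ℝ≥0∞) (s : GreedyState V) : Prop where
  time_ne_top : s.time ≠ ⊤
  mem_kept : ∀ v, v ∈ s.kept ↔ v ∈ s.tried ∧ d v ≤ T
  card_kept : s.kept.card ≤ K
  untried : ∀ v ∉ s.tried, s.schedule.followTime v = ⊤ ∧ s.schedule.unfollowTime v = ⊤
  follow_le : ∀ v ∈ s.tried, s.schedule.followTime v ≤ s.time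
  unfollow_kept : ∀ v ∈ s.kept, s.schedule.unfollowTime v = ⊤
  unfollow_dropped : ∀ v ∈ s.tried, v ∉ s.kept →
    s.schedule.unfollowTime v = s.schedule.followTime v + T ∧
      s.schedule.unfollowTime v ≤ s.time
  capacity : ∀ t, (s.schedule.followedAt t).card ≤ K

end GreedyState

open GreedyState

theorem isValid_init (K : ℕ) (T : ℝ≥0) (d : V → ℝ≥0∞) : (init V).IsValid K T d := by
  constructor <;> simp [init, Schedule.followedAt]

variable [DecidableEq V] {pick : Finset V → Finset V → V} {s : GreedyState V}

namespace GreedyState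

/-- The algorithm has not terminated: fewer than `K` users have reciprocated, and some user has not
been tried. -/
def IsRunning (K : ℕ) (s : GreedyState V) : Prop :=
  s.kept.card < K ∧ (s.tried)ᶜ.Nonempty

/-- The user tried in the next step. -/
def next (pick : Finset V → Finset V → V) (s : GreedyState V) : V :=
  pick s.kept (s.tried)ᶜ

end GreedyState

theorem practicalGreedyStep_of_not_isRunning (h : ¬ s.IsRunning K) :
    practicalGreedyStep K T pick d s = s :=
  if_neg h

theorem practicalGreedyStep_of_le (h : s.IsRunning K) (hd : d (s.next pick) ≤ T) :
    practicalGreedyStep K T pick d s =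
      { time := s.time + d (s.next pick)
        kept := insert (s.next pick) s.kept
        tried := insert (s.next pick) s.tried
        schedule :=
          { followTime := Function.update s.schedule.followTime (s.next pick) s.time
            unfollowTime := s.schedule.unfollowTime } } :=
  (if_pos h).trans (if_pos hd)

theorem practicalGreedyStep_of_lt (h : s.IsRunning K) (hd : ¬ d (s.next pick) ≤ T) :
    practicalGreedyStep K T pick d s =
      { time := s.time + T
        kept := s.kept
        tried := insert (s.next pick) s.tried
        schedule :=
          { followTime := Function.update s.schedule.followTime (s.next pick) s.time
            unfollowTime :=
              Function.update s.schedule.unfollowTime (s.next pick) (s.time + T) } } :=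
  (if_pos h).trans (if_neg hd)

theorem next_notMem_tried (hp : ∀ B C : Finset V, C.Nonempty → pick B C ∈ C)
    (h : s.IsRunning K) : s.next pick ∉ s.tried := by
  have := hp s.kept _ h.2
  rwa [Finset.mem_compl] at this

/-- A user who starts being followed when only the users kept so far are followed does not exceed
the capacity. -/
theorem card_followedAt_le_of_update (hs : s.IsValid K T d) (hr : s.IsRunning K) (v : V)
    (g : V → ℝ≥0∞) (hg : ∀ u, u ≠ v → g u = s.schedule.unfollowTime u) (t : ℝ≥0) :
    (Schedule.followedAt
      { followTime := Function.update s.schedule.followTime v s.time, unfollowTime := g } t).card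
      ≤ K := by
  rcases le_or_gt s.time t with ht | ht
  · refine (Finset.card_le_card (t := insert v s.kept) fun u hu => ?_).trans
      ((Finset.card_insert_le _ _).trans hr.1)
    simp only [Schedule.followedAt, Finset.mem_filter, Finset.mem_univ, true_and] at hu
    rw [Finset.mem_insert, or_iff_not_imp_left]
    intro huv
    rw [Function.update_of_ne huv, hg u huv] at hu
    by_contra hk
    by_cases hut : u ∈ s.tried
    · exact absurd hu.2 (not_lt.2 (((hs.unfollow_dropped u hut hk).2).trans ht))
    · rw [(hs.untried u hut).1] at hu
      simp at hu
  · refine (Finset.card_le_card fun u hu => ?_).trans (hs.capacity t)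
    simp only [Schedule.followedAt, Finset.mem_filter, Finset.mem_univ, true_and] at hu ⊢
    by_cases huv : u = v
    · subst huv
      rw [Function.update_self] at hu
      exact absurd hu.1 (not_le.2 ht)
    · rwa [Function.update_of_ne huv, hg u huv] at hu

theorem GreedyState.IsValid.step (hp : ∀ B C : Finset V, C.Nonempty → pick B C ∈ C)
    (hs : s.IsValid K T d) : (practicalGreedyStep K T pick d s).IsValid K T d := by
  by_cases hr : s.IsRunning K
  swap
  · rwa [practicalGreedyStep_of_not_isRunning hr]
  have hv := next_notMem_tried hp hr
  set v := s.next pick with hvdef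
  have hvk : v ∉ s.kept := fun h => hv ((hs.mem_kept v).1 h).1
  have hne : ∀ u ∈ s.tried, u ≠ v := fun u hu e => hv (e ▸ hu)
  by_cases hd : d v ≤ T
  · rw [practicalGreedyStep_of_le hr hd, ← hvdef]
    exact
      { time_ne_top := ENNReal.add_ne_top.2
          ⟨hs.time_ne_top, ne_top_of_le_ne_top ENNReal.coe_ne_top hd⟩
        mem_kept := fun u => by
          by_cases h : u = v
          · simp [h, hd]
          · simp [h, hs.mem_kept u]
        card_kept := (Finset.card_insert_le _ _).trans hr.1
        untried := fun u hu => by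
          simp only [Finset.mem_insert, not_or] at hu
          simpa [Function.update_of_ne hu.1] using hs.untried u hu.2
        follow_le := fun u hu => by
          by_cases h : u = v
          · simp [h]
          · simp only [Function.update_of_ne h]
            exact (hs.follow_le u (Finset.mem_of_mem_insert_of_ne hu h)).trans le_self_add
        unfollow_kept := fun u hu => by
          by_cases h : u = v
          · rw [h]
            exact (hs.untried v hv).2
          · exact hs.unfollow_kept u (Finset.mem_of_mem_insert_of_ne hu h)
        unfollow_dropped := fun u hu huk => by
          simp only [Finset.mem_insert, not_or] at huk
          have := hs.unfollow_dropped u (Finset.mem_of_mem_insert_of_ne hu huk.1) huk.2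
          simp only [Function.update_of_ne huk.1]
          exact ⟨this.1, this.2.trans le_self_add⟩
        capacity := card_followedAt_le_of_update hs hr v _ fun _ _ => rfl }
  · rw [practicalGreedyStep_of_lt hr hd, ← hvdef]
    exact
      { time_ne_top := ENNReal.add_ne_top.2 ⟨hs.time_ne_top, ENNReal.coe_ne_top⟩
        mem_kept := fun u => by
          by_cases h : u = v
          · simp [h, hd, hvk]
          · simp [h, hs.mem_kept u]
        card_kept := hs.card_kept
        untried := fun u hu => by
          simp only [Finset.mem_insert, not_or] at hu
          simpa [Function.update_of_ne hu.1] using hs.untried u hu.2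
        follow_le := fun u hu => by
          by_cases h : u = v
          · simp [h]
          · simp only [Function.update_of_ne h]
            exact (hs.follow_le u (Finset.mem_of_mem_insert_of_ne hu h)).trans le_self_add
        unfollow_kept := fun u hu => by
          have h : u ≠ v := fun e => hvk (e ▸ hu)
          simp only [Function.update_of_ne h]
          exact hs.unfollow_kept u hu
        unfollow_dropped := fun u hu huk => by
          by_cases h : u = v
          · simp [h]
          · simp only [Function.update_of_ne h]
            have := hs.unfollow_dropped u (Finset.mem_of_mem_insert_of_ne hu h) huk
            exact ⟨this.1, this.2.trans le_self_add⟩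
        capacity := card_followedAt_le_of_update hs hr v _ fun u hu =>
          Function.update_of_ne hu _ _ }

/-- The state of the practical greedy algorithm after `n` steps. -/
def greedyRun (K : ℕ) (T : ℝ≥0) (pick : Finset V → Finset V → V) (d : V → ℝ≥0∞) (n : ℕ) :
    GreedyState V :=
  (practicalGreedyStep K T pick d)^[n] (init V)

theorem practicalGreedy_eq :
    practicalGreedy K T pick d = (greedyRun K T pick d (Fintype.card V)).schedule := rfl

theorem greedyRun_succ (n : ℕ) :
    greedyRun K T pick d (n + 1) = practicalGreedyStep K T pick d (greedyRun K T pick d n) :=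
  Function.iterate_succ_apply' _ _ _

theorem isValid_greedyRun (hp : ∀ B C : Finset V, C.Nonempty → pick B C ∈ C) (n : ℕ) :
    (greedyRun K T pick d n).IsValid K T d := by
  induction n with
  | zero => exact isValid_init K T d
  | succ n ih =>
    rw [greedyRun_succ]
    exact ih.step hp

/-- A running algorithm tries a new user in each step; hence `|V|` steps reach termination. -/
theorem not_isRunning_or_card_tried (hp : ∀ B C : Finset V, C.Nonempty → pick B C ∈ C) (n : ℕ) :
    ¬ (greedyRun K T pick d n).IsRunning K ∨ (greedyRun K T pick d n).tried.card = n := by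
  induction n with
  | zero => right; rfl
  | succ n ih =>
    rw [greedyRun_succ]
    by_cases hr : (greedyRun K T pick d n).IsRunning K
    · right
      have hv := next_notMem_tried hp hr
      have hc := ih.resolve_left (not_not.2 hr)
      by_cases hd : d ((greedyRun K T pick d n).next pick) ≤ T
      · rw [practicalGreedyStep_of_le hr hd]
        exact (Finset.card_insert_of_notMem hv).trans (congrArg (· + 1) hc)
      · rw [practicalGreedyStep_of_lt hr hd]
        exact (Finset.card_insert_of_notMem hv).trans (congrArg (· + 1) hc)
    · left
      rwa [practicalGreedyStep_of_not_isRunning hr]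

theorem not_isRunning_greedyRun_card (hp : ∀ B C : Finset V, C.Nonempty → pick B C ∈ C) :
    ¬ (greedyRun K T pick d (Fintype.card V)).IsRunning K := by
  rcases not_isRunning_or_card_tried (K := K) (T := T) (d := d) hp (Fintype.card V) with h | h
  · exact h
  · intro hr
    have := Finset.card_eq_iff_eq_univ _ |>.1 h
    simpa [this] using hr.2

theorem GreedyState.IsValid.final_eq (hs : s.IsValid K T d) : s.schedule.final = s.kept := by
  ext v
  simp only [Schedule.final, Finset.mem_filter, Finset.mem_univ, true_and]
  constructor
  · rintro ⟨h1, h2⟩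
    by_contra hk
    by_cases ht : v ∈ s.tried
    · have := (hs.unfollow_dropped v ht hk).2
      rw [h2, top_le_iff] at this
      exact hs.time_ne_top this
    · exact h1 (hs.untried v ht).1
  · intro hk
    exact ⟨ne_top_of_le_ne_top hs.time_ne_top (hs.follow_le v ((hs.mem_kept v).1 hk).1),
      hs.unfollow_kept v hk⟩

theorem final_practicalGreedy (hp : ∀ B C : Finset V, C.Nonempty → pick B C ∈ C) :
    (practicalGreedy K T pick d).final = (greedyRun K T pick d (Fintype.card V)).kept :=
  (isValid_greedyRun hp _).final_eq

/-! ### The practical greedy algorithm is an online algorithm -/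

/-- Lets the follow time in the final schedule, to which the observations refer, be read off at the
step where the user is tried. -/
theorem followTime_iterate_of_mem_tried (hp : ∀ B C : Finset V, C.Nonempty → pick B C ∈ C)
    {v : V} (n : ℕ) : ∀ {s : GreedyState V}, v ∈ s.tried →
      ((practicalGreedyStep K T pick d)^[n] s).schedule.followTime v =
        s.schedule.followTime v := by
  induction n with
  | zero => exact fun _ => rfl
  | succ n ih =>
    intro s hv
    rw [Function.iterate_succ_apply]
    by_cases hr : s.IsRunning K
    · have hne : v ≠ s.next pick := fun e => next_notMem_tried hp hr (e ▸ hv)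
      by_cases hd : d (s.next pick) ≤ T
      · rw [practicalGreedyStep_of_le hr hd, ih (Finset.mem_insert_of_mem hv)]
        exact Function.update_of_ne hne _ _
      · rw [practicalGreedyStep_of_lt hr hd, ih (Finset.mem_insert_of_mem hv)]
        exact Function.update_of_ne hne _ _
    · rw [practicalGreedyStep_of_not_isRunning hr, ih hv]

/-- The steps that start after time `t` do not change the actions up to time `t`. -/
theorem same_iterate_of_lt_time (hp : ∀ B C : Finset V, C.Nonempty → pick B C ∈ C) {t : ℝ≥0}
    (n : ℕ) : ∀ {s : GreedyState V}, s.IsValid K T d → (t : ℝ≥0∞) < s.time →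
      s.schedule.Same t ((practicalGreedyStep K T pick d)^[n] s).schedule := by
  induction n with
  | zero => exact fun _ _ => .refl _ _
  | succ n ih =>
    intro s hs ht
    rw [Function.iterate_succ_apply]
    have hs' := hs.step (pick := pick) hp
    by_cases hr : s.IsRunning K
    · have hv := hs.untried _ (next_notMem_tried hp hr)
      have hstep : s.schedule.Same t (practicalGreedyStep K T pick d s).schedule ∧
          (t : ℝ≥0∞) < (practicalGreedyStep K T pick d s).time := by
        by_cases hd : d (s.next pick) ≤ T
        · rw [practicalGreedyStep_of_le hr hd]
          refine ⟨fun u => ⟨?_, .refl _ _⟩, ht.trans_le le_self_add⟩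
          by_cases h : u = s.next pick
          · subst h
            simp only [Function.update_self, hv.1]
            exact Or.inr ⟨ENNReal.coe_lt_top, ht⟩
          · simp only [Function.update_of_ne h]
            exact .refl _ _
        · rw [practicalGreedyStep_of_lt hr hd]
          refine ⟨fun u => ?_, ht.trans_le le_self_add⟩
          by_cases h : u = s.next pick
          · subst h
            simp only [Function.update_self, hv.1, hv.2]
            exact ⟨Or.inr ⟨ENNReal.coe_lt_top, ht⟩,
              Or.inr ⟨ENNReal.coe_lt_top, ht.trans_le le_self_add⟩⟩
          · simp only [Function.update_of_ne h]
            exact ⟨.refl _ _, .refl _ _⟩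
      exact hstep.1.trans (ih hs' hstep.2)
    · rw [practicalGreedyStep_of_not_isRunning hr]
      exact ih hs ht

/-- If the reciprocations of the user tried in a step look the same up to time `t`, this step has
the same result, or both results only differ after time `t`. -/
theorem practicalGreedyStep_same {t : ℝ≥0} (hs : s.IsValid K T d) (hr : s.IsRunning K)
    (hv : s.next pick ∉ s.tried)
    (h : SameUpTo t (s.time + d (s.next pick)) (s.time + d' (s.next pick))) :
    practicalGreedyStep K T pick d s = practicalGreedyStep K T pick d' s ∨
      ((practicalGreedyStep K T pick d s).schedule.Same t
          (practicalGreedyStep K T pick d' s).schedule ∧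
        (t : ℝ≥0∞) < (practicalGreedyStep K T pick d s).time ∧
        (t : ℝ≥0∞) < (practicalGreedyStep K T pick d' s).time) := by
  have hu := (hs.untried _ hv).2
  rcases h with h | ⟨h, h'⟩
  · left
    rw [ENNReal.add_right_inj hs.time_ne_top] at h
    by_cases hd : d (s.next pick) ≤ T
    · rw [practicalGreedyStep_of_le hr hd, practicalGreedyStep_of_le hr (h ▸ hd), h]
    · rw [practicalGreedyStep_of_lt hr hd, practicalGreedyStep_of_lt hr (h ▸ hd)]
  -- Both possible reciprocations lie after `t`. If one of them is in time, the deadline `s.time +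
  -- T` lies after `t` too, so keeping and dropping are indistinguishable up to `t`; if both are
  -- late, the steps coincide.
  · have hlate : ∀ a : ℝ≥0∞, a ≤ T → (t : ℝ≥0∞) < s.time + a → (t : ℝ≥0∞) < s.time + T :=
      fun a ha hta => hta.trans_le (by gcongr)
    have hdrop : ∀ b : ℝ≥0∞, b ≤ T → (t : ℝ≥0∞) < s.time + b → ∀ u,
        SameUpTo t (s.schedule.unfollowTime u)
          (Function.update s.schedule.unfollowTime (s.next pick) (s.time + T) u) := by
      intro b hb htb u
      by_cases hne : u = s.next pick
      · subst hne
        rw [Function.update_self, hu]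
        exact Or.inr ⟨ENNReal.coe_lt_top, hlate b hb htb⟩
      · rw [Function.update_of_ne hne]
        exact .refl _ _
    by_cases hd : d (s.next pick) ≤ T <;> by_cases hd' : d' (s.next pick) ≤ T
    · right
      rw [practicalGreedyStep_of_le hr hd, practicalGreedyStep_of_le hr hd']
      exact ⟨.refl _ _, h, h'⟩
    · right
      rw [practicalGreedyStep_of_le hr hd, practicalGreedyStep_of_lt hr hd']
      exact ⟨fun u => ⟨.refl _ _, hdrop _ hd h u⟩, h, hlate _ hd h⟩
    · right
      rw [practicalGreedyStep_of_lt hr hd, practicalGreedyStep_of_le hr hd']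
      exact ⟨fun u => ⟨.refl _ _, (hdrop _ hd' h' u).symm⟩, hlate _ hd' h', h'⟩
    · left
      rw [practicalGreedyStep_of_lt hr hd, practicalGreedyStep_of_lt hr hd']

/-- The two runs share their state until a step whose outcomes differ. By `practicalGreedyStep_same`
both clocks are then past `t`, and later steps leave the actions up to `t` unchanged. -/
theorem same_iterate (hp : ∀ B C : Finset V, C.Nonempty → pick B C ∈ C) {t : ℝ≥0} (n : ℕ) :
    ∀ {s : GreedyState V}, s.IsValid K T d → s.IsValid K T d' →
      (∀ v, ((practicalGreedyStep K T pick d)^[n] s).schedule.followTime v ≤ t →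
        SameUpTo t (((practicalGreedyStep K T pick d)^[n] s).schedule.followTime v + d v)
          (((practicalGreedyStep K T pick d)^[n] s).schedule.followTime v + d' v)) →
      ((practicalGreedyStep K T pick d)^[n] s).schedule.Same t
        ((practicalGreedyStep K T pick d')^[n] s).schedule := by
  induction n with
  | zero => exact fun _ _ _ => .refl _ _
  | succ n ih =>
    intro s hs hs' hobs
    by_cases hr : s.IsRunning K
    swap
    · simp only [Function.iterate_succ_apply, practicalGreedyStep_of_not_isRunning hr] at hobs ⊢
      exact ih hs hs' hobs
    rcases le_or_gt s.time t with ht | ht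
    swap
    · exact (same_iterate_of_lt_time hp _ hs ht).symm.trans (same_iterate_of_lt_time hp _ hs' ht)
    have hv := next_notMem_tried hp hr
    simp only [Function.iterate_succ_apply] at hobs ⊢
    have hfollow : ((practicalGreedyStep K T pick d)^[n]
        (practicalGreedyStep K T pick d s)).schedule.followTime (s.next pick) = s.time := by
      by_cases hd : d (s.next pick) ≤ T
      · rw [practicalGreedyStep_of_le hr hd,
          followTime_iterate_of_mem_tried hp n (Finset.mem_insert_self _ _)]
        exact Function.update_self _ _ _
      · rw [practicalGreedyStep_of_lt hr hd,
          followTime_iterate_of_mem_tried hp n (Finset.mem_insert_self _ _)]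
        exact Function.update_self _ _ _
    have hnext := hobs (s.next pick) (by rwa [hfollow])
    rw [hfollow] at hnext
    have h1 := hs.step (pick := pick) hp
    have h2 := hs'.step (pick := pick) hp
    rcases practicalGreedyStep_same hs hr hv hnext with h | ⟨h, ht1, ht2⟩
    · rw [← h] at h2 ⊢
      exact ih h1 h2 hobs
    · exact ((same_iterate_of_lt_time hp _ h1 ht1).symm.trans h).trans
        (same_iterate_of_lt_time hp _ h2 ht2)

theorem isOnlineAlgorithm_practicalGreedy (hp : ∀ B C : Finset V, C.Nonempty → pick B C ∈ C) :
    IsOnlineAlgorithm K T (practicalGreedy K T pick) where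
  follow_le_unfollow d v := by
    have hs := isValid_greedyRun (K := K) (T := T) (d := d) hp (Fintype.card V)
    rw [practicalGreedy_eq]
    by_cases hk : v ∈ (greedyRun K T pick d (Fintype.card V)).kept
    · simp [hs.unfollow_kept v hk]
    · by_cases ht : v ∈ (greedyRun K T pick d (Fintype.card V)).tried
      · rw [(hs.unfollow_dropped v ht hk).1]
        exact le_self_add
      · simp [(hs.untried v ht).2]
  capacity d t := (isValid_greedyRun hp _).capacity t
  drop_late d v hv := by
    have hs := isValid_greedyRun (K := K) (T := T) (d := d) hp (Fintype.card V)
    rw [practicalGreedy_eq]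
    have hk : v ∉ (greedyRun K T pick d (Fintype.card V)).kept := fun h =>
      absurd ((hs.mem_kept v).1 h).2 (not_le.2 hv)
    by_cases ht : v ∈ (greedyRun K T pick d (Fintype.card V)).tried
    · exact (hs.unfollow_dropped v ht hk).1.le
    · simp [(hs.untried v ht).1]
  nonanticipative d d' _ h :=
    same_iterate hp _ (isValid_init K T d) (isValid_init K T d') h

/-! ### Comparison with the clairvoyant greedy algorithm -/

/-- Tried users who reciprocate are kept. So the clairvoyant candidates are among the untried users,
and a maximizer over the latter that reciprocates is a maximizer over the former. -/
theorem reciprocating_sdiff_kept_subset (hs : s.IsValid K T d) :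
    reciprocating T d \ s.kept ⊆ (s.tried)ᶜ := fun v hv => by
  rw [Finset.mem_sdiff, mem_reciprocating, hs.mem_kept] at hv
  exact Finset.mem_compl.2 fun h => hv.2 ⟨h, hv.1⟩

/-- The practical greedy algorithm makes the same selections as the clairvoyant one if the selection
rule of the latter makes the choices observed in the run. -/
theorem kept_eq_clairvoyantGreedy (hp : ∀ B C : Finset V, C.Nonempty → pick B C ∈ C)
    {pick' : Finset V → Finset V → V}
    (h : ∀ n, (greedyRun K T pick d n).IsRunning K →
      d ((greedyRun K T pick d n).next pick) ≤ T →
      pick' (greedyRun K T pick d n).kept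
        (reciprocating T d \ (greedyRun K T pick d n).kept) = (greedyRun K T pick d n).next pick)
    (n : ℕ) : (greedyRun K T pick d n).kept =
      clairvoyantGreedy pick' (reciprocating T d) (greedyRun K T pick d n).kept.card := by
  induction n with
  | zero => simp [greedyRun, init, clairvoyantGreedy]
  | succ n ih =>
    rw [greedyRun_succ]
    by_cases hr : (greedyRun K T pick d n).IsRunning K
    swap
    · rwa [practicalGreedyStep_of_not_isRunning hr]
    by_cases hd : d ((greedyRun K T pick d n).next pick) ≤ T
    · have hv := next_notMem_tried hp hr
      have hvk : (greedyRun K T pick d n).next pick ∉ (greedyRun K T pick d n).kept := fun hk =>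
        hv (((isValid_greedyRun hp n).mem_kept _).1 hk).1
      have hpick := h n hr hd
      rw [practicalGreedyStep_of_le hr hd]
      simp only [Finset.card_insert_of_notMem hvk, clairvoyantGreedy_succ, ← ih, hpick]
      rw [if_pos ⟨_, Finset.mem_sdiff.2 ⟨mem_reciprocating.2 hd, hvk⟩⟩]
    · rwa [practicalGreedyStep_of_lt hr hd]

theorem final_eq_clairvoyantGreedy (hp : ∀ B C : Finset V, C.Nonempty → pick B C ∈ C)
    {pick' : Finset V → Finset V → V}
    (h : ∀ n, (greedyRun K T pick d n).IsRunning K →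
      d ((greedyRun K T pick d n).next pick) ≤ T →
      pick' (greedyRun K T pick d n).kept
        (reciprocating T d \ (greedyRun K T pick d n).kept) =
          (greedyRun K T pick d n).next pick) :
    (practicalGreedy K T pick d).final = clairvoyantGreedy pick' (reciprocating T d) K := by
  rw [final_practicalGreedy hp]
  have hs := isValid_greedyRun (K := K) (T := T) (d := d) hp (Fintype.card V)
  have hk := kept_eq_clairvoyantGreedy hp h (Fintype.card V)
  have hhalt := not_isRunning_greedyRun_card (K := K) (T := T) (d := d) hp
  -- Either `K` users are kept, or all users have been tried and the kept ones are exactly `R`,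
  -- where the clairvoyant algorithm stays.
  rcases hs.card_kept.eq_or_lt with hc | hc
  · rwa [hc] at hk
  · have htried : (greedyRun K T pick d (Fintype.card V)).tried = Finset.univ := by
      by_contra hne
      refine hhalt ⟨hc, ?_⟩
      rwa [Finset.nonempty_iff_ne_empty, Ne, Finset.compl_eq_empty_iff]
    have hR : (greedyRun K T pick d (Fintype.card V)).kept = reciprocating T d := by
      ext v
      rw [hs.mem_kept, htried, mem_reciprocating]
      simp
    rw [clairvoyantGreedy_eq_of_le (hk.symm.trans hR) hc.le, hR]

theorem kept_subset_succ (n : ℕ) :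
    (greedyRun K T pick d n).kept ⊆ (greedyRun K T pick d (n + 1)).kept := by
  rw [greedyRun_succ]
  by_cases hr : (greedyRun K T pick d n).IsRunning K
  · by_cases hd : d ((greedyRun K T pick d n).next pick) ≤ T
    · rw [practicalGreedyStep_of_le hr hd]
      exact Finset.subset_insert _ _
    · rw [practicalGreedyStep_of_lt hr hd]
  · rw [practicalGreedyStep_of_not_isRunning hr]

/-- The set of users who have reciprocated changes after a successful step. -/
theorem kept_ne_of_lt (hp : ∀ B C : Finset V, C.Nonempty → pick B C ∈ C) {m n : ℕ} (hmn : m < n)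
    (hr : (greedyRun K T pick d m).IsRunning K)
    (hd : d ((greedyRun K T pick d m).next pick) ≤ T) :
    (greedyRun K T pick d m).kept ≠ (greedyRun K T pick d n).kept := by
  intro he
  have hmem : (greedyRun K T pick d m).next pick ∈ (greedyRun K T pick d (m + 1)).kept := by
    rw [greedyRun_succ, practicalGreedyStep_of_le hr hd]
    exact Finset.mem_insert_self _ _
  have hsub : (greedyRun K T pick d (m + 1)).kept ⊆ (greedyRun K T pick d n).kept :=
    monotone_nat_of_le_succ (f := fun n => (greedyRun K T pick d n).kept) kept_subset_succ hmn
  exact next_notMem_tried hp hr (((isValid_greedyRun hp m).mem_kept _).1 (he ▸ hsub hmem)).1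

/-- The delays shift the clock, but the selections depend only on who reciprocates in time.
Measurability of the result thus reduces to finitely many events. -/
theorem kept_and_tried_eq_of_reciprocating_eq
    (h : reciprocating T d = reciprocating T d') (n : ℕ) :
    (greedyRun K T pick d n).kept = (greedyRun K T pick d' n).kept ∧
      (greedyRun K T pick d n).tried = (greedyRun K T pick d' n).tried := by
  induction n with
  | zero => exact ⟨rfl, rfl⟩
  | succ n ih =>
    rw [greedyRun_succ, greedyRun_succ]
    have hrr : (greedyRun K T pick d n).IsRunning K ↔ (greedyRun K T pick d' n).IsRunning K := by
      simp only [IsRunning, ih.1, ih.2]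
    have hnn : (greedyRun K T pick d n).next pick = (greedyRun K T pick d' n).next pick := by
      simp only [next, ih.1, ih.2]
    have hdd : ∀ v, d v ≤ T ↔ d' v ≤ T := fun v => by
      rw [← mem_reciprocating, h, mem_reciprocating]
    by_cases hr : (greedyRun K T pick d n).IsRunning K
    · by_cases hd : d ((greedyRun K T pick d n).next pick) ≤ T
      · rw [practicalGreedyStep_of_le hr hd, practicalGreedyStep_of_le (hrr.1 hr)
          (hnn ▸ (hdd _).1 hd)]
        simp only [hnn, ih.1, ih.2, and_self]
      · rw [practicalGreedyStep_of_lt hr hd, practicalGreedyStep_of_lt (hrr.1 hr)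
          (hnn ▸ fun h' => hd ((hdd _).2 h'))]
        simp only [hnn, ih.1, ih.2, and_self]
    · rwa [practicalGreedyStep_of_not_isRunning hr,
        practicalGreedyStep_of_not_isRunning fun h' => hr (hrr.2 h')]

theorem measurableSet_reciprocating_eq (T : ℝ≥0) (R : Finset V) :
    MeasurableSet {d : V → ℝ≥0∞ | reciprocating T d = R} := by
  have : {d : V → ℝ≥0∞ | reciprocating T d = R} =
      ⋂ v, {d : V → ℝ≥0∞ | d v ≤ T ↔ v ∈ R} := by
    ext d
    simp [Finset.ext_iff]
  rw [this]
  refine MeasurableSet.iInter fun v => ?_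
  have hm : MeasurableSet {d : V → ℝ≥0∞ | d v ≤ T} :=
    measurableSet_le (measurable_pi_apply v) measurable_const
  by_cases hv : v ∈ R
  · simpa only [hv, iff_true] using hm
  · simp only [hv, iff_false]
    exact hm.compl

theorem measurableSet_final_practicalGreedy
    (hp : ∀ B C : Finset V, C.Nonempty → pick B C ∈ C) (B : Finset V) :
    MeasurableSet {d : V → ℝ≥0∞ | (practicalGreedy K T pick d).final = B} := by
  have : {d : V → ℝ≥0∞ | (practicalGreedy K T pick d).final = B} =
      ⋃ R ∈ {R | ∃ d : V → ℝ≥0∞, reciprocating T d = R ∧ (practicalGreedy K T pick d).final = B},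
        {d : V → ℝ≥0∞ | reciprocating T d = R} := by
    ext d
    simp only [Set.mem_ofPred_eq, Set.mem_iUnion, exists_prop]
    constructor
    · exact fun hd => ⟨_, ⟨d, rfl, hd⟩, rfl⟩
    · rintro ⟨R, ⟨d', hd', hB⟩, hd⟩
      rw [← hB, final_practicalGreedy hp, final_practicalGreedy hp]
      exact (kept_and_tried_eq_of_reciprocating_eq (hd.trans hd'.symm) _).1
  rw [this]
  exact MeasurableSet.biUnion (Set.to_countable _) fun R _ => measurableSet_reciprocating_eq T R

end

/-! ### Approximation for each realization, and the final average -/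

noncomputable section

open GreedyState

namespace DecreasingCascade

variable {V : Type*} [Fintype V] [DecidableEq V] {M : DecreasingCascade V} {K : ℕ} {T : ℝ≥0}
  {pick : Finset V → Finset V → V}

theorem next_mem_reciprocating_sdiff (hp : ∀ B C : Finset V, C.Nonempty → pick B C ∈ C)
    {d : V → ℝ≥0∞} {s : GreedyState V} (hs : s.IsValid K T d) (hr : s.IsRunning K)
    (hd : d (s.next pick) ≤ T) : s.next pick ∈ reciprocating T d \ s.kept :=
  Finset.mem_sdiff.2 ⟨mem_reciprocating.2 hd, fun hk =>
    next_notMem_tried hp hr ((hs.mem_kept _).1 hk).1⟩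

open Classical in
/-- The practical greedy algorithm implements the clairvoyant one for some way of breaking ties. -/
theorem exists_isGreedyRule_final_eq (hpick : M.IsGreedyRule pick) (d : V → ℝ≥0∞) :
    ∃ pick' : Finset V → Finset V → V, M.IsGreedyRule pick' ∧
      (practicalGreedy K T pick d).final = clairvoyantGreedy pick' (reciprocating T d) K := by
  have hp : ∀ B C : Finset V, C.Nonempty → pick B C ∈ C := fun B C h => (hpick B C h).1
  -- `Q B C n` says that step `n` succeeds from the state `B` with clairvoyant candidates `C`. The
  -- rule `pick'` replays such a step and otherwise follows `pick`.
  let Q : Finset V → Finset V → ℕ → Prop := fun B C n =>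
    (greedyRun K T pick d n).IsRunning K ∧ d ((greedyRun K T pick d n).next pick) ≤ T ∧
      (greedyRun K T pick d n).kept = B ∧ reciprocating T d \ B = C
  let pick' : Finset V → Finset V → V := fun B C =>
    if h : ∃ n, Q B C n then (greedyRun K T pick d h.choose).next pick else pick B C
  refine ⟨pick', fun B C hC => ?_, final_eq_clairvoyantGreedy hp fun n hr hd => ?_⟩
  · by_cases h : ∃ n, Q B C n
    · have hpick' : pick' B C = (greedyRun K T pick d h.choose).next pick := dif_pos h
      obtain ⟨hr, hd, hB, hR⟩ := h.choose_spec
      have hs := isValid_greedyRun (K := K) (T := T) (d := d) hp h.choose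
      rw [hpick']
      generalize greedyRun K T pick d h.choose = s at *
      subst hB hR
      exact ⟨next_mem_reciprocating_sdiff hp hs hr hd, fun w hw =>
        (hpick s.kept _ hr.2).2 w (reciprocating_sdiff_kept_subset hs hw)⟩
    · have hpick' : pick' B C = pick B C := dif_neg h
      rw [hpick']
      exact hpick B C hC
  · have h : ∃ m, Q (greedyRun K T pick d n).kept
        (reciprocating T d \ (greedyRun K T pick d n).kept) m := ⟨n, hr, hd, rfl, rfl⟩
    have hpick' : pick' (greedyRun K T pick d n).kept
        (reciprocating T d \ (greedyRun K T pick d n).kept) =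
          (greedyRun K T pick d h.choose).next pick := dif_pos h
    obtain ⟨hr', hd', hB, -⟩ := h.choose_spec
    rw [hpick']
    -- The kept set grows strictly at a successful step, so it determines the index of that step and
    -- the replayed step is the right one.
    rcases lt_trichotomy h.choose n with hlt | heq | hlt
    · exact absurd hB (kept_ne_of_lt hp hlt hr' hd')
    · rw [heq]
    · exact absurd hB.symm (kept_ne_of_lt hp hlt hr hd)

theorem final_eq_clairvoyantGreedy_of_breaksTiesConsistently
    (hp : ∀ B C : Finset V, C.Nonempty → pick B C ∈ C) (hc : BreaksTiesConsistently pick)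
    (d : V → ℝ≥0∞) :
    (practicalGreedy K T pick d).final = clairvoyantGreedy pick (reciprocating T d) K :=
  final_eq_clairvoyantGreedy hp fun n hr hd => by
    have hs := isValid_greedyRun (K := K) (T := T) (d := d) hp n
    exact hc _ _ _ (reciprocating_sdiff_kept_subset hs)
      (next_mem_reciprocating_sdiff hp hs hr hd)

/-- Pointwise in the delays: knowing `R` in advance, the clairvoyant greedy algorithm competes with
every feasible set, in particular with the result of `A`. -/
theorem expectedRetweets_practicalGreedy_ge (hpick : M.IsGreedyRule pick)
    {A : (V → ℝ≥0∞) → Schedule V} (hA : IsOnlineAlgorithm K T A) (d : V → ℝ≥0∞) :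
    (1 - 1 / Real.exp 1) * M.expectedRetweets (A d).final ≤
      M.expectedRetweets (practicalGreedy K T pick d).final := by
  obtain ⟨pick', hpick', h⟩ := exists_isGreedyRule_final_eq (K := K) (T := T) hpick d
  rw [h]
  exact greedy_bound (fun _ _ => expectedRetweets_mono)
    (fun _ _ hB w => expectedRetweets_submodular hB w) (expectedRetweets_nonneg ∅) hpick'
    (hA.final_subset d) (hA.card_final_le d)

end DecreasingCascade

end

theorem proposition3 {V : Type*} [Fintype V] [DecidableEq V] (M : DecreasingCascade V)
    (K : ℕ) (T : ℝ≥0) (hT : 0 < T)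
    (pick : Finset V → Finset V → V) (hpick : M.IsGreedyRule pick) :
    -- the practical greedy algorithm is an online algorithm
    IsOnlineAlgorithm K T (practicalGreedy K T pick) ∧
    -- it implements the greedy algorithm that knows which users reciprocate
    (∀ d : V → ℝ≥0∞, ∃ pick' : Finset V → Finset V → V, M.IsGreedyRule pick' ∧
      (practicalGreedy K T pick d).final = clairvoyantGreedy pick' (reciprocating T d) K) ∧
    (BreaksTiesConsistently pick → ∀ d : V → ℝ≥0∞,
      (practicalGreedy K T pick d).final = clairvoyantGreedy pick (reciprocating T d) K) ∧
    -- its outcome is a random variable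
    (∀ B : Finset V, MeasurableSet {d : V → ℝ≥0∞ | (practicalGreedy K T pick d).final = B}) ∧
    -- for every joint law `μ` of the delays, it is a `(1 - 1/e)`-approximation of every online
    -- algorithm `A`, possibly randomized by an independent seed of law `ν`
    (∀ (μ : Measure (V → ℝ≥0∞)) [IsProbabilityMeasure μ]
      (Ω : Type*) [MeasurableSpace Ω] (ν : Measure Ω) [IsProbabilityMeasure ν]
      (A : Ω → (V → ℝ≥0∞) → Schedule V),
      (∀ ω, IsOnlineAlgorithm K T (A ω)) →
      (∀ B : Finset V, MeasurableSet {x : Ω × (V → ℝ≥0∞) | (A x.1 x.2).final = B}) →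
      (1 - 1 / Real.exp 1) * ∫ x, M.expectedRetweets (A x.1 x.2).final ∂(ν.prod μ) ≤
        ∫ d, M.expectedRetweets (practicalGreedy K T pick d).final ∂μ) := by
  have hp : ∀ B C : Finset V, C.Nonempty → pick B C ∈ C := fun B C h => (hpick B C h).1
  refine ⟨isOnlineAlgorithm_practicalGreedy hp,
    DecreasingCascade.exists_isGreedyRule_final_eq hpick,
    DecreasingCascade.final_eq_clairvoyantGreedy_of_breaksTiesConsistently hp,
    measurableSet_final_practicalGreedy hp, ?_⟩
  intro μ _ Ω _ ν _ A hA hAm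
  have hG := integrable_comp_of_fintype μ
    (measurableSet_final_practicalGreedy (K := K) (T := T) hp) M.expectedRetweets
  rw [← integral_const_mul]
  -- The practical greedy algorithm ignores the seed, so its expectation may be taken over the
  -- product space and the comparison made pointwise there.
  have hsnd : ∫ d, M.expectedRetweets (practicalGreedy K T pick d).final ∂μ =
      ∫ x : Ω × (V → ℝ≥0∞),
        M.expectedRetweets (practicalGreedy K T pick x.2).final ∂(ν.prod μ) := by
    rw [integral_fun_snd fun d => M.expectedRetweets (practicalGreedy K T pick d).final]
    simp
  rw [hsnd]
  exact integral_mono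
    ((integrable_comp_of_fintype (ν.prod μ) hAm M.expectedRetweets).const_mul _)
    (hG.comp_snd ν) fun x =>
      DecreasingCascade.expectedRetweets_practicalGreedy_ge hpick (hA x.1) x.2
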